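/- **Setup.** For each $n$ let $X_n$ be a random $n\times p(n)$ real matrix that is right-rotationally invariant, i.e. $X_nO$ has the same law as $X_n$ for every orthogonal $p(n)\times p(n)$ matrix $O$. Let $X_n=Q_n^\top D_nO_n$ be its singular value decomposition ($Q_n,O_n$ orthogonal, $D_n$ rectangular diagonal with nonnegative entries). Let $y_n=X_n\beta_n+\varepsilon_n$, and assume: * there is a constant $C$ such that almost surely the largest singular value of $X_n$ is at most $C$ for all large $n$; * $p(n)/n\to\gamma\in(0,\infty)$; * $\beta_n\in\mathbb R^{p(n)}$ is fixed, or random and independent of $X_n$, with $\|\beta_n\|/\sqrt n=r$ for all $n\ge1$; * $\varepsilon_n\in\mathbb R^n$ is independent of $(X_n,\beta_n)$, with independent entries satisfying $\mathbb E\,\varepsilon_{n,i}=0$, $\mathbb E\,\varepsilon_{n,i}^2=\sigma^2$ and, for some $\eta>0$, $\sup_{n,i}\mathbb E|\varepsilon_{n,i}|^{4+\eta}<\infty$. For $\lambda>0$ let $\hat\beta_\lambda=(X_n^\top X_n+\lambda I)^{-1}X_n^\top y_n$ be the ridge estimator, $S_\lambda=X_n(X_n^\top X_n+\lambda I)^{-1}X_n^\top$,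 and $$\mathsf{GCV}_n(\lambda)=\frac1n\sum_{i=1}^n\Big(\frac{y_{n,i}-(X_n\hat\beta_\lambda)_i}{1-\mathrm{Tr}(S_\lambda)/n}\Big)^2 .$$ Let $v_D(z)=\frac1n\sum_{i=1}^n\frac1{(D_nD_n^\top)_{ii}-z}$ be the Stieltjes transform of the empirical measure of the diagonal entries of $D_nD_n^\top$, and $v_D'$ its derivative in $z$. **Theorem.** (i) For every $\lambda>0$, $$\mathsf{GCV}_n(\lambda)-\frac{r^2\big(v_D(-\lambda)-\lambda v_D'(-\lambda)\big)+\sigma^2\gamma\,v_D'(-\lambda)}{\gamma\,v_D(-\lambda)^2}\longrightarrow0\quad\text{almost surely.}$$ (ii) When the rows of $X_n$ are not independent, this need not match the true risk. More precisely, there exist a sequence as in the setup with $r,\sigma>0$, in which for every $n\ge2$ the rows of $X_n$ are not independent, and test designs $X_n'$ that have the law of $X_n$, are independent of $(X_n,\beta_n,\varepsilon_n)$ and satisfy $\mathbb E\,\mathrm{Tr}(X_n'^\top X_n')=p(n)$, such that, with the out-of-sample risk $R_n(\lambda)=\frac1n\mathbb E\big[\|X_n'\hat\beta_\lambda-X_n'\beta_n\|^2\,\big|\,X_n,y_n\big]$,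 for every $\lambda>0$ almost surely neither the expression subtracted in (i) minus $R_n(\lambda)+\sigma^2$ nor $\mathsf{GCV}_n(\lambda)-(R_n(\lambda)+\sigma^2)$ converges to $0$. -/

import Mathlib

open MeasureTheory ProbabilityTheory Filter Topology Matrix

noncomputable section

namespace RotiGCV

/-- The ridge estimator `(XᵀX + lam I)⁻¹ Xᵀ y`. -/
def ridge {n p : ℕ} (X : Matrix (Fin n) (Fin p) ℝ) (y : Fin n → ℝ) (lam : ℝ) : Fin p → ℝ :=
  (Xᵀ * X + lam • (1 : Matrix (Fin p) (Fin p) ℝ))⁻¹ *ᵥ (Xᵀ *ᵥ y)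

/-- For `lam > 0` the closed form above is the unique minimizer of the ridge objective
`‖y - X b‖² + lam ‖b‖²`. -/
theorem ridge_unique_argmin {n p : ℕ} (X : Matrix (Fin n) (Fin p) ℝ) (y : Fin n → ℝ) {lam : ℝ}
    (hlam : 0 < lam) (b : Fin p → ℝ) (hb : b ≠ ridge X y lam) :
    (y - X *ᵥ ridge X y lam) ⬝ᵥ (y - X *ᵥ ridge X y lam)
        + lam * (ridge X y lam ⬝ᵥ ridge X y lam)
      < (y - X *ᵥ b) ⬝ᵥ (y - X *ᵥ b) + lam * (b ⬝ᵥ b) := by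
  set A : Matrix (Fin p) (Fin p) ℝ := Xᵀ * X + lam • (1 : Matrix (Fin p) (Fin p) ℝ) with hA
  have hpd : A.PosDef := by
    have h1 : (Xᵀ * X).PosSemidef := by
      simpa using Matrix.posSemidef_conjTranspose_mul_self X
    have h2 : (lam • (1 : Matrix (Fin p) (Fin p) ℝ)).PosDef := Matrix.PosDef.one.smul hlam
    exact Matrix.PosDef.posSemidef_add h1 h2
  have hu : IsUnit A.det := (Matrix.isUnit_iff_isUnit_det A).1 hpd.isUnit
  set w := ridge X y lam with hw
  have hnormal : A *ᵥ w = Xᵀ *ᵥ y := by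
    rw [hw, ridge, Matrix.mulVec_mulVec, ← hA, Matrix.mul_nonsing_inv _ hu, Matrix.one_mulVec]
  have hnormal' : Xᵀ *ᵥ (X *ᵥ w) + lam • w = Xᵀ *ᵥ y := by
    rw [← hnormal, hA, Matrix.add_mulVec, Matrix.mulVec_mulVec, Matrix.smul_mulVec,
      Matrix.one_mulVec]
  obtain ⟨d, rfl⟩ : ∃ d, b = w + d := ⟨b - w, by simp⟩
  have hd : d ≠ 0 := by
    rintro rfl
    exact hb (by simp)
  have hdpos : 0 < d ⬝ᵥ d := by
    have h0 : 0 ≤ d ⬝ᵥ d := Finset.sum_nonneg fun i _ => mul_self_nonneg (d i)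
    exact lt_of_le_of_ne h0 fun h => hd (dotProduct_self_eq_zero.1 h.symm)
  have hXd : 0 ≤ (X *ᵥ d) ⬝ᵥ (X *ᵥ d) :=
    Finset.sum_nonneg fun i _ => mul_self_nonneg _
  have key : (y - X *ᵥ w) ⬝ᵥ (X *ᵥ d) = lam * (w ⬝ᵥ d) := by
    have h3 : (y - X *ᵥ w) ⬝ᵥ (X *ᵥ d) = (Xᵀ *ᵥ (y - X *ᵥ w)) ⬝ᵥ d := by
      rw [Matrix.dotProduct_mulVec, Matrix.mulVec_transpose]
    rw [h3, Matrix.mulVec_sub, ← hnormal', add_sub_cancel_left, smul_dotProduct, smul_eq_mul]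
  have hexp : (y - X *ᵥ (w + d)) ⬝ᵥ (y - X *ᵥ (w + d))
      = (y - X *ᵥ w) ⬝ᵥ (y - X *ᵥ w) - 2 * ((y - X *ᵥ w) ⬝ᵥ (X *ᵥ d))
        + (X *ᵥ d) ⬝ᵥ (X *ᵥ d) := by
    rw [Matrix.mulVec_add, ← sub_sub]
    simp only [sub_dotProduct, dotProduct_sub, dotProduct_comm (X *ᵥ d)]
    ring
  have hexp2 : (w + d) ⬝ᵥ (w + d) = w ⬝ᵥ w + 2 * (w ⬝ᵥ d) + d ⬝ᵥ d := by
    simp only [add_dotProduct, dotProduct_add, dotProduct_comm d w]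
    ring
  rw [hexp, hexp2, key]
  nlinarith [mul_pos hlam hdpos]

/-- The smoother matrix `X (XᵀX + lam I)⁻¹ Xᵀ`. -/
def smoother {n p : ℕ} (X : Matrix (Fin n) (Fin p) ℝ) (lam : ℝ) : Matrix (Fin n) (Fin n) ℝ :=
  X * (Xᵀ * X + lam • (1 : Matrix (Fin p) (Fin p) ℝ))⁻¹ * Xᵀ

/-- The classical generalized cross-validation criterion. -/
def gcv {n p : ℕ} (X : Matrix (Fin n) (Fin p) ℝ) (y : Fin n → ℝ) (lam : ℝ) : ℝ :=
  (1 / (n : ℝ)) *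
    ∑ i, ((y i - (X *ᵥ ridge X y lam) i) / (1 - (smoother X lam).trace / (n : ℝ))) ^ 2

/-- The Stieltjes transform `m(μ, z) = ∫ 1 / (x - z) dμ(x)`, at real arguments `z` (it is used
below only for finitely supported `μ` on `[0, ∞)` and `z` near a negative number). -/
def stieltjes (μ : Measure ℝ) (z : ℝ) : ℝ := ∫ x, 1 / (x - z) ∂μ

/-- The empirical measure of `a 0, …, a (n - 1)`. -/
def empiricalMeasure {n : ℕ} (a : Fin n → ℝ) : Measure ℝ :=
  (n : ENNReal)⁻¹ • ∑ i, Measure.dirac (a i)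

/-- The companion Stieltjes transform `v_D`: the Stieltjes transform of the empirical measure of
the diagonal entries of `D Dᵀ`. -/
def vD {n p : ℕ} (D : Matrix (Fin n) (Fin p) ℝ) (z : ℝ) : ℝ :=
  stieltjes (empiricalMeasure (D * Dᵀ).diag) z

/-- `[r² (v_D(-lam) - lam v_D'(-lam)) + σ² γ v_D'(-lam)] / (γ v_D(-lam)²)`. -/
def gcvEquivalent {n p : ℕ} (γ r σ : ℝ) (D : Matrix (Fin n) (Fin p) ℝ) (lam : ℝ) : ℝ :=
  (r ^ 2 * (vD D (-lam) - lam * deriv (vD D) (-lam)) + σ ^ 2 * γ * deriv (vD D) (-lam))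
    / (γ * vD D (-lam) ^ 2)

/-- `X = Qᵀ D O` is a singular value decomposition: `Q`, `O` are orthogonal and `D` is
rectangular diagonal with nonnegative entries. -/
structure IsSVD {n p : ℕ} (X : Matrix (Fin n) (Fin p) ℝ) (Q : Matrix (Fin n) (Fin n) ℝ)
    (D : Matrix (Fin n) (Fin p) ℝ) (O : Matrix (Fin p) (Fin p) ℝ) : Prop where
  left_orthogonal : Q ∈ Matrix.orthogonalGroup (Fin n) ℝ
  right_orthogonal : O ∈ Matrix.orthogonalGroup (Fin p) ℝ
  diagonal : ∀ (i : Fin n) (j : Fin p), (i : ℕ) ≠ (j : ℕ) → D i j = 0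
  nonneg : ∀ (i : Fin n) (j : Fin p), 0 ≤ D i j
  eq : X = Qᵀ * D * O

/-- The entrywise (Borel) σ-algebra on matrices. -/
instance matrixMeasurableSpace {n p : ℕ} : MeasurableSpace (Matrix (Fin n) (Fin p) ℝ) :=
  inferInstanceAs (MeasurableSpace (Fin n → Fin p → ℝ))

/-- The random matrix `X` is right-rotationally invariant: `X O` has the law of `X` for every
orthogonal matrix `O`. -/
def RightRotationallyInvariant {Ω : Type*} [MeasurableSpace Ω] (P : Measure Ω) {n p : ℕ}
    (X : Ω → Matrix (Fin n) (Fin p) ℝ) : Prop :=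
  ∀ O ∈ Matrix.orthogonalGroup (Fin p) ℝ, P.map (fun ω => X ω * O) = P.map X

/-- The response `y = X β + ε`. -/
def response {Ω : Type*} {n p : ℕ} (X : Ω → Matrix (Fin n) (Fin p) ℝ) (β : Ω → Fin p → ℝ)
    (ε : Ω → Fin n → ℝ) (ω : Ω) : Fin n → ℝ :=
  X ω *ᵥ β ω + ε ω

/-- The assumptions on the training data: for each `n`, an `n × p n` right-rotationally invariant
design `X n = (Q n)ᵀ (D n) (O n)`, a signal `β n` and a noise vector `ε n`. -/
structure TrainingModel {Ω : Type*} [MeasurableSpace Ω] (P : Measure Ω) (γ r σ : ℝ) (p : ℕ → ℕ)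
    (X : (n : ℕ) → Ω → Matrix (Fin n) (Fin (p n)) ℝ)
    (Q : (n : ℕ) → Ω → Matrix (Fin n) (Fin n) ℝ)
    (D : (n : ℕ) → Ω → Matrix (Fin n) (Fin (p n)) ℝ)
    (O : (n : ℕ) → Ω → Matrix (Fin (p n)) (Fin (p n)) ℝ)
    (β : (n : ℕ) → Ω → Fin (p n) → ℝ)
    (ε : (n : ℕ) → Ω → Fin n → ℝ) : Prop where
  measurable_design : ∀ n, Measurable (X n)
  measurable_signal : ∀ n, Measurable (β n)
  measurable_noise : ∀ n, Measurable (ε n)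
  /-- Each design is right-rotationally invariant. -/
  invariant : ∀ n, RightRotationallyInvariant P (X n)
  /-- `Q n`, `D n`, `O n` form a singular value decomposition of `X n`. -/
  svd : ∀ n, ∀ᵐ ω ∂P, IsSVD (X n ω) (Q n ω) (D n ω) (O n ω)
  /-- The largest singular value is almost surely asymptotically bounded by a constant. -/
  bounded : ∃ C : ℝ, ∀ᵐ ω ∂P, ∀ᶠ n in atTop, ∀ i j, D n ω i j ≤ C
  /-- The aspect ratio converges to `γ`. -/
  aspect_ratio : Tendsto (fun n : ℕ => (p n : ℝ) / (n : ℝ)) atTop (𝓝 γ)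
  /-- The Euclidean norm of the signal is `r √n`. -/
  signal_norm : ∀ n, 1 ≤ n → ∀ᵐ ω ∂P, ‖WithLp.toLp 2 (β n ω)‖ / √(n : ℝ) = r
  /-- The signal is fixed or random, independent of the design. -/
  signal_indep : ∀ n, IndepFun (β n) (X n) P
  /-- The noise is independent of everything else. -/
  noise_indep : ∀ n, IndepFun (ε n) (fun ω => (X n ω, β n ω)) P
  /-- The noise entries are independent. -/
  noise_entries_indep : ∀ n, iIndepFun (fun (i : Fin n) ω => ε n ω i) P
  noise_mean : ∀ n i, ∫ ω, ε n ω i ∂P = 0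
  noise_variance : ∀ n i, ∫ ω, ε n ω i ^ 2 ∂P = σ ^ 2
  /-- The noise entries have uniformly bounded moments of some order `4 + η > 4`. -/
  noise_moment : ∃ η > (0 : ℝ), ∃ M : ℝ, ∀ n i,
    Integrable (fun ω => |ε n ω i| ^ (4 + η)) P ∧ ∫ ω, |ε n ω i| ^ (4 + η) ∂P ≤ M

/-- The out-of-sample risk `(1 / n') E[‖X' β̂ - X' β‖² | X, y]` of the ridge estimator, where `X'`
is an `n' × p` test design. -/
def risk {Ω : Type*} [MeasurableSpace Ω] (P : Measure Ω) {n n' p : ℕ}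
    (X : Ω → Matrix (Fin n) (Fin p) ℝ) (β : Ω → Fin p → ℝ) (y : Ω → Fin n → ℝ)
    (X' : Ω → Matrix (Fin n') (Fin p) ℝ) (lam : ℝ) (ω : Ω) : ℝ :=
  (1 / (n' : ℝ)) *
    (condExp (MeasurableSpace.comap (fun ω => (X ω, y ω)) inferInstance) P
      (fun ω => ‖WithLp.toLp 2 (X' ω *ᵥ ridge (X ω) (y ω) lam - X' ω *ᵥ β ω)‖ ^ 2)) ω

end RotiGCV

end

/-! Write `G` for the resolvent of `X Xᵀ` at `-lam`. The ridge residual is `lam • G y` and `1 - tr S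
/ n = lam * tr G / n`, so the factors `lam` cancel and GCV is `(‖G y‖² / n) / (tr G / n)²`
(`gcv_eq`). The denominator is exactly `v_D(-lam)²`. With `y = X b + e` the numerator splits into a
signal form `bᵀ B b`, `B = Xᵀ G² X`, a noise form `eᵀ G² e` and a cross term linear in `e`
(`residual_sq_eq`). Since `tr G² = n v_D'` and `tr B = n (v_D - lam v_D')`, replacing the two forms
by `(tr B / p) ‖b‖²` and `σ² tr G²` gives the claimed equivalent, up to `p / n` in place of `γ`
(`IsSVD.gcv_sub_gcvEquivalent`).

The fluctuations are negligible because their moments, conditional on the frozen variables, are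
summable in `n`. The cross term and the off-diagonal noise have fourth moment of order `n⁻²` after
division by `n` (`CenteredFamily.linear`, `CenteredFamily.quadratic`). The diagonal noise is a sum
of multiples of `e i ^ 2 - σ ^ 2`, which has slightly more than two moments, and a moment of order
`2 + δ` suffices (`sum_abs_moment_le`). For the signal form, rotating `X` amounts to rotating `b`,
so by invariance its fourth moment depends on `b` only through the norm. Then `b` may be replaced by
a scaled vector of random signs and the off-diagonal bound applies again
(`lintegral_signalForm_le`). Bounded singular values keep `v_D` away from zero (`le_vD`).

For the counterexample the training and test designs are independent Haar orthogonal matrices with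
`p = n`, the signal is the all-ones vector and the noise consists of random signs. All singular
values are `1`, and the equivalent is `2` for every `lam`. The test design preserves norms, so the
risk is `‖β̂ - β‖² / n`, which tends to `(lam² + 1) / (1 + lam)²`. The gap to risk plus noise level
tends to `2 lam / (1 + lam)² > 0`. -/

noncomputable section

namespace RotiGCV

/-! ### Resolvent identities and operator bounds -/

section Resolvent

variable {n p : ℕ} (X : Matrix (Fin n) (Fin p) ℝ) {lam : ℝ}

/-- The resolvent `(X Xᵀ + lam I)⁻¹`. -/
def resolvent (lam : ℝ) : Matrix (Fin n) (Fin n) ℝ :=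
  (X * Xᵀ + lam • (1 : Matrix (Fin n) (Fin n) ℝ))⁻¹

theorem isUnit_det_mul_transpose_add (hlam : 0 < lam) :
    IsUnit (X * Xᵀ + lam • (1 : Matrix (Fin n) (Fin n) ℝ)).det := by
  have h1 : (X * Xᵀ).PosSemidef := by
    simpa using Matrix.posSemidef_self_mul_conjTranspose X
  have h2 : (lam • (1 : Matrix (Fin n) (Fin n) ℝ)).PosDef := Matrix.PosDef.one.smul hlam
  exact (Matrix.isUnit_iff_isUnit_det _).1 (Matrix.PosDef.posSemidef_add h1 h2).isUnit

theorem mul_resolvent (hlam : 0 < lam) :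
    (X * Xᵀ + lam • (1 : Matrix (Fin n) (Fin n) ℝ)) * resolvent X lam = 1 :=
  Matrix.mul_nonsing_inv _ (isUnit_det_mul_transpose_add X hlam)

theorem resolvent_mul (hlam : 0 < lam) :
    resolvent X lam * (X * Xᵀ + lam • (1 : Matrix (Fin n) (Fin n) ℝ)) = 1 :=
  Matrix.nonsing_inv_mul _ (isUnit_det_mul_transpose_add X hlam)

theorem resolvent_transpose : (resolvent X lam)ᵀ = resolvent X lam := by
  simp [resolvent, Matrix.transpose_nonsing_inv]

theorem resolvent_mul_gram (hlam : 0 < lam) :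
    resolvent X lam * (X * Xᵀ) = 1 - lam • resolvent X lam := by
  have := resolvent_mul X hlam
  rw [Matrix.mul_add, Matrix.mul_smul, Matrix.mul_one] at this
  exact eq_sub_of_add_eq this

/-- The push-through identity `X (XᵀX + lam)⁻¹ = (X Xᵀ + lam)⁻¹ X` trades the `p × p` inverse for
the `n × n` one. -/
theorem smoother_eq (hlam : 0 < lam) : smoother X lam = 1 - lam • resolvent X lam := by
  have hu : IsUnit (Xᵀ * X + lam • (1 : Matrix (Fin p) (Fin p) ℝ)).det := by
    simpa using isUnit_det_mul_transpose_add Xᵀ hlam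
  have h : X * (Xᵀ * X + lam • (1 : Matrix (Fin p) (Fin p) ℝ))⁻¹ = resolvent X lam * X := by
    have h0 : (X * Xᵀ + lam • (1 : Matrix (Fin n) (Fin n) ℝ)) * X
        = X * (Xᵀ * X + lam • (1 : Matrix (Fin p) (Fin p) ℝ)) := by
      simp [Matrix.add_mul, Matrix.mul_add, Matrix.mul_assoc]
    calc _ = resolvent X lam * ((X * Xᵀ + lam • (1 : Matrix (Fin n) (Fin n) ℝ)) * X)
          * (Xᵀ * X + lam • (1 : Matrix (Fin p) (Fin p) ℝ))⁻¹ := by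
            rw [← Matrix.mul_assoc (resolvent X lam), resolvent_mul X hlam, Matrix.one_mul]
      _ = _ := by
            rw [h0, Matrix.mul_assoc, Matrix.mul_assoc, Matrix.mul_nonsing_inv _ hu,
              Matrix.mul_one]
  rw [smoother, h, Matrix.mul_assoc, resolvent_mul_gram X hlam]

theorem mulVec_ridge (y : Fin n → ℝ) : X *ᵥ ridge X y lam = smoother X lam *ᵥ y := by
  simp [ridge, smoother, Matrix.mulVec_mulVec, Matrix.mul_assoc]

/-- By `smoother_eq` the residual and the trace correction both carry a factor `lam`, which cancels
in the quotient. -/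
theorem gcv_eq (hn : n ≠ 0) (hlam : 0 < lam) (y : Fin n → ℝ) :
    gcv X y lam = (1 / (n : ℝ)) * ((resolvent X lam *ᵥ y) ⬝ᵥ (resolvent X lam *ᵥ y))
      / ((resolvent X lam).trace / n) ^ 2 := by
  have hn' : (n : ℝ) ≠ 0 := by exact_mod_cast hn
  have h1 : 1 - (smoother X lam).trace / n = lam * ((resolvent X lam).trace / n) := by
    rw [smoother_eq X hlam]
    simp only [Matrix.trace_sub, Matrix.trace_one, Matrix.trace_smul, Fintype.card_fin,
      smul_eq_mul]
    field_simp
    ring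
  have h2 : ∀ i, y i - (X *ᵥ ridge X y lam) i = lam * (resolvent X lam *ᵥ y) i := by
    intro i
    rw [mulVec_ridge, smoother_eq X hlam, Matrix.sub_mulVec, Matrix.smul_mulVec]
    simp
  simp only [gcv, h1, h2, mul_div_mul_left _ _ hlam.ne', dotProduct, div_pow]
  rw [← Finset.sum_div, mul_div_assoc]
  simp only [pow_two]

theorem dotProduct_self_nonneg' {m : ℕ} (w : Fin m → ℝ) : 0 ≤ w ⬝ᵥ w :=
  Finset.sum_nonneg fun i _ => mul_self_nonneg (w i)

theorem dotProduct_sq_le {m : ℕ} (u w : Fin m → ℝ) : (u ⬝ᵥ w) ^ 2 ≤ (u ⬝ᵥ u) * (w ⬝ᵥ w) := by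
  simpa only [dotProduct, pow_two] using Finset.sum_mul_sq_le_sq_mul_sq Finset.univ u w

/-- Pair `(X Xᵀ + lam) u = w` with `u`. This one identity yields the norm bounds for `G`, `Xᵀ G` and
`G X` without any spectral decomposition. -/
theorem resolvent_energy (hlam : 0 < lam) (w : Fin n → ℝ) :
    (Xᵀ *ᵥ (resolvent X lam *ᵥ w)) ⬝ᵥ (Xᵀ *ᵥ (resolvent X lam *ᵥ w))
      + lam * ((resolvent X lam *ᵥ w) ⬝ᵥ (resolvent X lam *ᵥ w))
      = (resolvent X lam *ᵥ w) ⬝ᵥ w := by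
  set u := resolvent X lam *ᵥ w with hu
  have hw : w = X *ᵥ (Xᵀ *ᵥ u) + lam • u := by
    have h : (X * Xᵀ + lam • (1 : Matrix (Fin n) (Fin n) ℝ)) *ᵥ u = w := by
      rw [hu, Matrix.mulVec_mulVec, mul_resolvent X hlam, Matrix.one_mulVec]
    conv_lhs => rw [← h]
    rw [Matrix.add_mulVec, Matrix.smul_mulVec, Matrix.one_mulVec, ← Matrix.mulVec_mulVec]
  conv_rhs => rw [hw]
  rw [dotProduct_add, dotProduct_smul, smul_eq_mul, Matrix.dotProduct_mulVec u X,
    Matrix.mulVec_transpose]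

theorem resolvent_mulVec_sq_le (hlam : 0 < lam) (w : Fin n → ℝ) :
    (resolvent X lam *ᵥ w) ⬝ᵥ (resolvent X lam *ᵥ w) ≤ (w ⬝ᵥ w) / lam ^ 2 := by
  have h := resolvent_energy X hlam w
  set u := resolvent X lam *ᵥ w
  have h1 := dotProduct_self_nonneg' (Xᵀ *ᵥ u)
  have h2 := dotProduct_sq_le u w
  have hu := dotProduct_self_nonneg' u
  have hw := dotProduct_self_nonneg' w
  rw [le_div_iff₀ (by positivity)]
  by_contra! hc
  have h3 : (lam * (u ⬝ᵥ u)) ^ 2 ≤ (u ⬝ᵥ u) * (w ⬝ᵥ w) :=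
    le_trans (pow_le_pow_left₀ (by positivity) (by linarith) 2) h2
  have hpos : 0 < u ⬝ᵥ u := by
    rcases hu.eq_or_lt with h0 | h0
    · rw [← h0] at hc; linarith
    · exact h0
  nlinarith

theorem transpose_resolvent_mulVec_sq_le (hlam : 0 < lam) (w : Fin n → ℝ) :
    (Xᵀ *ᵥ (resolvent X lam *ᵥ w)) ⬝ᵥ (Xᵀ *ᵥ (resolvent X lam *ᵥ w)) ≤ (w ⬝ᵥ w) / lam := by
  have h := resolvent_energy X hlam w
  set u := resolvent X lam *ᵥ w
  have h1 := dotProduct_self_nonneg' (w - lam • u)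
  have hw := dotProduct_self_nonneg' w
  have hu := dotProduct_self_nonneg' u
  simp only [sub_dotProduct, dotProduct_sub, smul_dotProduct, dotProduct_smul, smul_eq_mul,
    dotProduct_comm w u] at h1
  have hx := dotProduct_self_nonneg' (Xᵀ *ᵥ u)
  have hl : lam * (Xᵀ *ᵥ u ⬝ᵥ Xᵀ *ᵥ u) + lam * (lam * (u ⬝ᵥ u)) = lam * (u ⬝ᵥ w) := by
    rw [← h]; ring
  have hlu : 0 ≤ lam * (lam * (u ⬝ᵥ u)) := by positivity
  rw [le_div_iff₀ hlam]
  linarith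

/-- `G X` is the adjoint of `Xᵀ G`, so the preceding bound transfers by Cauchy–Schwarz. The constant
is independent of the size of `X`. -/
theorem resolvent_mul_mulVec_sq_le (hlam : 0 < lam) (b : Fin p → ℝ) :
    (resolvent X lam *ᵥ (X *ᵥ b)) ⬝ᵥ (resolvent X lam *ᵥ (X *ᵥ b)) ≤ (b ⬝ᵥ b) / lam := by
  set z := resolvent X lam *ᵥ (X *ᵥ b) with hz
  have h1 : z ⬝ᵥ z = (Xᵀ *ᵥ (resolvent X lam *ᵥ z)) ⬝ᵥ b := by
    conv_lhs => rw [hz]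
    rw [← hz, dotProduct_comm, Matrix.dotProduct_mulVec, ← Matrix.mulVec_transpose,
      resolvent_transpose, Matrix.dotProduct_mulVec, ← Matrix.mulVec_transpose]
  have h2 := dotProduct_sq_le (Xᵀ *ᵥ (resolvent X lam *ᵥ z)) b
  rw [← h1] at h2
  have h3 := transpose_resolvent_mulVec_sq_le X hlam z
  have hz0 := dotProduct_self_nonneg' z
  have hb := dotProduct_self_nonneg' b
  rw [le_div_iff₀ hlam] at h3 ⊢
  by_contra! hc
  have hpos : 0 < z ⬝ᵥ z := by
    rcases hz0.eq_or_lt with h0 | h0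
    · rw [← h0] at hc; linarith
    · exact h0
  nlinarith

end Resolvent

/-! ### The signal form and its behaviour under rotations -/

/-- `Xᵀ G² X` for the resolvent `G` of `X Xᵀ`. -/
def signalMatrix {n p : ℕ} (X : Matrix (Fin n) (Fin p) ℝ) (lam : ℝ) :
    Matrix (Fin p) (Fin p) ℝ :=
  Xᵀ * (resolvent X lam * resolvent X lam) * X

section SignalMatrix

variable {n p : ℕ} (X : Matrix (Fin n) (Fin p) ℝ) {lam : ℝ}

theorem signalMatrix_transpose : (signalMatrix X lam)ᵀ = signalMatrix X lam := by
  simp [signalMatrix, Matrix.transpose_mul, resolvent_transpose, Matrix.mul_assoc]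

/-- Cyclicity together with `G X Xᵀ = 1 - lam G` leaves only traces of powers of `G`, hence only
`v_D` and its derivative in the limit. -/
theorem trace_signalMatrix (hlam : 0 < lam) :
    (signalMatrix X lam).trace
      = (resolvent X lam).trace - lam * (resolvent X lam * resolvent X lam).trace := by
  rw [signalMatrix, Matrix.mul_assoc, Matrix.trace_mul_comm, Matrix.mul_assoc, Matrix.mul_assoc,
    resolvent_mul_gram X hlam, Matrix.mul_sub]
  simp

/-- The column is the image of a basis vector. An operator bound thus becomes the column bound that
`CenteredFamily.quadratic` takes as input. -/
theorem sum_sq_col {m : ℕ} (A : Matrix (Fin m) (Fin m) ℝ) {τ : ℝ}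
    (h : ∀ w, (A *ᵥ w) ⬝ᵥ (A *ᵥ w) ≤ τ * (w ⬝ᵥ w)) (k : Fin m) : ∑ i, A i k ^ 2 ≤ τ := by
  have := h (Pi.single k 1)
  simpa [dotProduct, pow_two, Pi.single_apply] using this

theorem sum_sq_col_resolvent_sq (hlam : 0 < lam) (k : Fin n) :
    ∑ i, (resolvent X lam * resolvent X lam) i k ^ 2 ≤ (1 / lam ^ 2) ^ 2 := by
  refine sum_sq_col _ (fun w => ?_) k
  rw [← Matrix.mulVec_mulVec]
  refine (resolvent_mulVec_sq_le X hlam _).trans ?_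
  refine (div_le_div_of_nonneg_right (resolvent_mulVec_sq_le X hlam _) (by positivity)).trans ?_
  apply le_of_eq
  field_simp

theorem sum_sq_col_signalMatrix (hlam : 0 < lam) (k : Fin p) :
    ∑ i, signalMatrix X lam i k ^ 2 ≤ (1 / lam) ^ 2 := by
  refine sum_sq_col _ (fun w => ?_) k
  rw [signalMatrix, Matrix.mul_assoc, ← Matrix.mulVec_mulVec, Matrix.mul_assoc,
    ← Matrix.mulVec_mulVec, ← Matrix.mulVec_mulVec]
  refine (transpose_resolvent_mulVec_sq_le X hlam _).trans ?_
  refine (div_le_div_of_nonneg_right (resolvent_mul_mulVec_sq_le X hlam _) hlam.le).trans ?_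
  apply le_of_eq
  field_simp

theorem resolvent_mul_orthogonal {O : Matrix (Fin p) (Fin p) ℝ}
    (hO : O ∈ Matrix.orthogonalGroup (Fin p) ℝ) : resolvent (X * O) lam = resolvent X lam := by
  have h : O * Oᵀ = 1 := (Matrix.mem_orthogonalGroup_iff _ _).1 hO
  have h2 : X * O * (X * O)ᵀ = X * Xᵀ := by
    rw [Matrix.transpose_mul, Matrix.mul_assoc, ← Matrix.mul_assoc O, h, Matrix.one_mul]
  rw [resolvent, resolvent, h2]

theorem signalMatrix_mul_orthogonal {O : Matrix (Fin p) (Fin p) ℝ}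
    (hO : O ∈ Matrix.orthogonalGroup (Fin p) ℝ) :
    signalMatrix (X * O) lam = Oᵀ * signalMatrix X lam * O := by
  simp only [signalMatrix, resolvent_mul_orthogonal X hO, Matrix.transpose_mul, Matrix.mul_assoc]

/-- The centred quadratic form `bᵀ (B - (tr B / p) I) b` of the signal matrix `B`. -/
def signalForm (lam : ℝ) (b : Fin p → ℝ) : ℝ :=
  b ⬝ᵥ (signalMatrix X lam *ᵥ b) - (signalMatrix X lam).trace / p * (b ⬝ᵥ b)

theorem orthogonal_mulVec_dotProduct {m : ℕ} {O : Matrix (Fin m) (Fin m) ℝ}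
    (hO : O ∈ Matrix.orthogonalGroup (Fin m) ℝ) (b c : Fin m → ℝ) :
    (O *ᵥ b) ⬝ᵥ (O *ᵥ c) = b ⬝ᵥ c := by
  have h : Oᵀ * O = 1 := (Matrix.mem_orthogonalGroup_iff' _ _).1 hO
  rw [Matrix.dotProduct_mulVec, ← Matrix.mulVec_transpose, Matrix.mulVec_mulVec, h,
    Matrix.one_mulVec]

/-- A rotation leaves `X Xᵀ`, hence `G`, unchanged and conjugates `B`, which preserves the trace.
Rotating the design therefore has the same effect as rotating the signal, and this is how right
invariance of the law is used. -/
theorem signalForm_mul_orthogonal {O : Matrix (Fin p) (Fin p) ℝ}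
    (hO : O ∈ Matrix.orthogonalGroup (Fin p) ℝ) (b : Fin p → ℝ) :
    signalForm (X * O) lam b = signalForm X lam (O *ᵥ b) := by
  have h : O * Oᵀ = 1 := (Matrix.mem_orthogonalGroup_iff _ _).1 hO
  have ht : (Oᵀ * signalMatrix X lam * O).trace = (signalMatrix X lam).trace := by
    rw [Matrix.trace_mul_comm, ← Matrix.mul_assoc, h, Matrix.one_mul]
  rw [signalForm, signalForm, signalMatrix_mul_orthogonal X hO, ht,
    orthogonal_mulVec_dotProduct hO]
  congr 1
  rw [← Matrix.mulVec_mulVec, ← Matrix.mulVec_mulVec, Matrix.dotProduct_mulVec,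
    Matrix.vecMul_transpose]

theorem signalForm_smul (c : ℝ) (b : Fin p → ℝ) :
    signalForm X lam (c • b) = c ^ 2 * signalForm X lam b := by
  simp only [signalForm, Matrix.mulVec_smul, dotProduct_smul, smul_dotProduct, smul_eq_mul]
  ring

end SignalMatrix

/-- The orthogonal group acts transitively on each sphere. -/
theorem exists_orthogonal_mulVec_eq {m : ℕ} {b c : Fin m → ℝ} (h : b ⬝ᵥ b = c ⬝ᵥ c) :
    ∃ O ∈ Matrix.orthogonalGroup (Fin m) ℝ, O *ᵥ b = c := by
  by_cases hbc : b = c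
  · exact ⟨1, one_mem _, by simp [hbc]⟩
  set v := b - c with hv
  have hv0 : v ≠ 0 := sub_ne_zero.2 hbc
  have hvv : v ⬝ᵥ v ≠ 0 := fun h0 => hv0 (dotProduct_self_eq_zero.1 h0)
  have hvb : v ⬝ᵥ v = 2 * (v ⬝ᵥ b) := by
    simp only [hv, sub_dotProduct, dotProduct_sub, dotProduct_comm c b, ← h]
    ring
  have hsq : Matrix.vecMulVec v v * Matrix.vecMulVec v v = (v ⬝ᵥ v) • Matrix.vecMulVec v v := by
    rw [Matrix.vecMulVec_mul_vecMulVec, Matrix.vecMulVec_smul]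
  -- The Householder reflection along `b - c`; equality of the norms is what makes it send `b` to
  -- `c`.
  refine ⟨1 - (2 / (v ⬝ᵥ v)) • Matrix.vecMulVec v v, ?_, ?_⟩
  · rw [Matrix.mem_orthogonalGroup_iff]
    simp only [Matrix.transpose_sub, Matrix.transpose_one, Matrix.transpose_smul,
      Matrix.transpose_vecMulVec]
    simp only [Matrix.sub_mul, Matrix.mul_sub, Matrix.one_mul, Matrix.mul_one,
      Matrix.smul_mul, Matrix.mul_smul, hsq, smul_smul, smul_sub]
    have : 2 / (v ⬝ᵥ v) * (2 / (v ⬝ᵥ v) * (v ⬝ᵥ v)) = 2 / (v ⬝ᵥ v) + 2 / (v ⬝ᵥ v) := by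
      field_simp; norm_num
    rw [this, add_smul]
    abel
  · rw [Matrix.sub_mulVec, Matrix.smul_mulVec, Matrix.one_mulVec, Matrix.vecMulVec_mulVec]
    have : (2 / (v ⬝ᵥ v)) * (v ⬝ᵥ b) = 1 := by
      rw [div_mul_eq_mul_div, ← hvb, div_self hvv]
    ext i
    have h2 := congrArg (· * v i) this
    simp [hv] at h2 ⊢
    linarith

/-! ### Fourth moments of linear and quadratic forms in independent variables -/

section Moments

variable {Ω : Type*} [MeasurableSpace Ω] {P : Measure Ω}

/-- One step of the fourth moment induction for polynomials in independent variables. -/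
theorem fourth_moment_step [IsProbabilityMeasure P] {x q L : Ω → ℝ} {κ : ℝ} (hx : Measurable x) (hq : Measurable q)
    (hL : Measurable L) (hind : IndepFun x (fun ω => (q ω, L ω)) P)
    (hx4 : Integrable (fun ω => x ω ^ 4) P) (hq4 : Integrable (fun ω => q ω ^ 4) P)
    (hL4 : Integrable (fun ω => L ω ^ 4) P) (hx0 : ∫ ω, x ω ∂P = 0)
    (hx2 : ∫ ω, x ω ^ 2 ∂P ≤ κ) (hx4' : ∫ ω, x ω ^ 4 ∂P ≤ κ) :
    Integrable (fun ω => (q ω + x ω * L ω) ^ 4) P ∧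
    Integrable (fun ω => q ω ^ 2 * L ω ^ 2) P ∧
    ∫ ω, (q ω + x ω * L ω) ^ 4 ∂P
      ≤ ∫ ω, q ω ^ 4 ∂P + 8 * κ * ∫ ω, q ω ^ 2 * L ω ^ 2 ∂P + 3 * κ * ∫ ω, L ω ^ 4 ∂P := by
  have ix1 : Integrable x P := by
    refine ((integrable_const (1 : ℝ)).add hx4).mono' hx.aestronglyMeasurable (ae_of_all _ fun ω => ?_)
    rw [Real.norm_eq_abs, Pi.add_apply, abs_le]
    constructor <;> nlinarith [sq_nonneg (x ω ^ 2 - 1/2), sq_nonneg (x ω - 1/2), sq_nonneg (x ω + 1/2)]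
  have ix2 : Integrable (fun ω => x ω ^ 2) P := by
    refine ((integrable_const (1 : ℝ)).add hx4).mono' (by fun_prop) (ae_of_all _ fun ω => ?_)
    rw [Real.norm_eq_abs, Pi.add_apply, abs_of_nonneg (by positivity)]
    nlinarith [sq_nonneg (x ω ^ 2 - 1)]
  have iqL2 : Integrable (fun ω => q ω ^ 2 * L ω ^ 2) P := by
    refine (hq4.add hL4).mono' (by fun_prop) (ae_of_all _ fun ω => ?_)
    rw [Real.norm_eq_abs, Pi.add_apply, abs_of_nonneg (by positivity)]
    nlinarith [sq_nonneg (q ω ^ 2 - L ω ^ 2), sq_nonneg (q ω ^ 2), sq_nonneg (L ω ^ 2)]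
  have iq3L : Integrable (fun ω => q ω ^ 3 * L ω) P := by
    refine (hq4.add hL4).mono' (by fun_prop) (ae_of_all _ fun ω => ?_)
    rw [Real.norm_eq_abs, Pi.add_apply, abs_le]
    have h1 : 0 ≤ q ω ^ 2 * (q ω - L ω) ^ 2 := by positivity
    have h2 : 0 ≤ q ω ^ 2 * (q ω + L ω) ^ 2 := by positivity
    constructor <;>
    nlinarith [sq_nonneg (q ω ^ 2 - L ω ^ 2), sq_nonneg (q ω ^ 2), sq_nonneg (L ω ^ 2)]
  have ind1 : IndepFun x (fun ω => q ω ^ 3 * L ω) P :=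
    hind.comp (φ := id) (ψ := fun z : ℝ × ℝ => z.1 ^ 3 * z.2) measurable_id (by fun_prop)
  have ind2 : IndepFun (fun ω => x ω ^ 2) (fun ω => q ω ^ 2 * L ω ^ 2) P :=
    hind.comp (φ := fun t => t ^ 2) (ψ := fun z : ℝ × ℝ => z.1 ^ 2 * z.2 ^ 2) (by fun_prop)
      (by fun_prop)
  have ind4 : IndepFun (fun ω => x ω ^ 4) (fun ω => L ω ^ 4) P :=
    hind.comp (φ := fun t => t ^ 4) (ψ := fun z : ℝ × ℝ => z.2 ^ 4) (by fun_prop) (by fun_prop)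
  have i1 : Integrable (fun ω => x ω * (q ω ^ 3 * L ω)) P := ind1.integrable_mul ix1 iq3L
  have i2 : Integrable (fun ω => x ω ^ 2 * (q ω ^ 2 * L ω ^ 2)) P := ind2.integrable_mul ix2 iqL2
  have i4 : Integrable (fun ω => x ω ^ 4 * L ω ^ 4) P := ind4.integrable_mul hx4 hL4
  have e1 : ∫ ω, x ω * (q ω ^ 3 * L ω) ∂P = 0 := by
    rw [ind1.integral_fun_mul_eq_mul_integral (by fun_prop) (by fun_prop), hx0, zero_mul]
  have e2 := ind2.integral_fun_mul_eq_mul_integral (by fun_prop) (by fun_prop)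
  have e4 := ind4.integral_fun_mul_eq_mul_integral (by fun_prop) (by fun_prop)
  -- The cubic term obeys `4 q (xL)³ ≤ 2 q² (xL)² + 2 (xL)⁴`, which turns the binomial coefficients
  -- 6 and 1 into 8 and 3. No third moment is needed, and the term linear in `x` integrates to zero.
  have key : ∀ ω, (q ω + x ω * L ω) ^ 4 ≤ q ω ^ 4 + 4 * (x ω * (q ω ^ 3 * L ω))
      + 8 * (x ω ^ 2 * (q ω ^ 2 * L ω ^ 2)) + 3 * (x ω ^ 4 * L ω ^ 4) := by
    intro ω
    have : 0 ≤ 2 * (x ω * L ω) ^ 2 * (q ω - x ω * L ω) ^ 2 := by positivity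
    nlinarith
  have iR : Integrable (fun ω => q ω ^ 4 + 4 * (x ω * (q ω ^ 3 * L ω))
      + 8 * (x ω ^ 2 * (q ω ^ 2 * L ω ^ 2)) + 3 * (x ω ^ 4 * L ω ^ 4)) P :=
    ((hq4.add (i1.const_mul 4)).add (i2.const_mul 8)).add (i4.const_mul 3)
  have iL : Integrable (fun ω => (q ω + x ω * L ω) ^ 4) P := by
    refine iR.mono' (by fun_prop) (ae_of_all _ fun ω => ?_)
    rw [Real.norm_eq_abs, abs_of_nonneg (by positivity)]
    exact key ω
  refine ⟨iL, iqL2, (integral_mono iL iR key).trans ?_⟩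
  have iA : Integrable (fun ω => q ω ^ 4 + 4 * (x ω * (q ω ^ 3 * L ω))) P :=
    hq4.add (i1.const_mul 4)
  have iB : Integrable (fun ω => q ω ^ 4 + 4 * (x ω * (q ω ^ 3 * L ω))
      + 8 * (x ω ^ 2 * (q ω ^ 2 * L ω ^ 2))) P := iA.add (i2.const_mul 8)
  rw [integral_add iB (i4.const_mul 3), integral_add iA (i2.const_mul 8),
    integral_add hq4 (i1.const_mul 4), integral_const_mul, integral_const_mul,
    integral_const_mul, e1, e2, e4]
  have n1 : 0 ≤ ∫ ω, q ω ^ 2 * L ω ^ 2 ∂P := integral_nonneg fun ω => by positivity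
  have n2 : 0 ≤ ∫ ω, L ω ^ 4 ∂P := integral_nonneg fun ω => by positivity
  have m1 := mul_le_mul_of_nonneg_right hx2 n1
  have m2 := mul_le_mul_of_nonneg_right hx4' n2
  linarith

/-- Independent centred variables with second and fourth moments bounded by `κ`. -/
structure CenteredFamily {ι : Type*} (P : Measure Ω) (e : ι → Ω → ℝ) (κ : ℝ) : Prop where
  measurable : ∀ i, Measurable (e i)
  indep : iIndepFun e P
  integrable : ∀ i, Integrable (fun ω => e i ω ^ 4) P
  mean : ∀ i, ∫ ω, e i ω ∂P = 0
  second : ∀ i, ∫ ω, e i ω ^ 2 ∂P ≤ κ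
  fourth : ∀ i, ∫ ω, e i ω ^ 4 ∂P ≤ κ
  one_le : 1 ≤ κ

/-- A variable of an independent family is independent of each function of other variables. -/
theorem indepFun_of_notMem {ι β : Type*} [MeasurableSpace β] {e : ι → Ω → ℝ}
    (hm : ∀ i, Measurable (e i)) (h : iIndepFun e P) {s : Finset ι} {k : ι} (hk : k ∉ s)
    {f : (ι → ℝ) → β} (hf : Measurable f)
    (hdep : ∀ z z' : ι → ℝ, (∀ i ∈ s, z i = z' i) → f z = f z') :
    IndepFun (e k) (fun ω => f (fun i => e i ω)) P := by
  classical
  have h1 := h.indepFun_finset {k} s (by simpa using hk) hm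
  have hφ : Measurable fun z : ({k} : Finset ι) → ℝ => z ⟨k, Finset.mem_singleton_self k⟩ :=
    measurable_pi_apply _
  have h2 := h1.comp (φ := fun z : ({k} : Finset ι) → ℝ => z ⟨k, Finset.mem_singleton_self k⟩)
    -- Coordinates outside `s` are filled with 0; by `hdep` the value of `f` does not see them.
    (ψ := fun z : s → ℝ => f (fun i => if hi : i ∈ s then z ⟨i, hi⟩ else 0))
    hφ (by
      refine hf.comp (measurable_pi_lambda _ fun i => ?_)
      by_cases hi : i ∈ s
      · simp only [hi, dif_pos]; exact measurable_pi_apply _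
      · simp only [hi, dif_neg, not_false_eq_true]; fun_prop)
  refine h2.congr (ae_of_all _ fun ω => rfl) (ae_of_all _ fun ω => ?_)
  refine hdep _ _ fun i hi => ?_
  simp [hi]

/-- Add one variable at a time, with the constant `a k` in the role of `L`. The increment is at most
`8 κ² V a² + 3 κ a⁴`. It fits into `4 κ² ((V + a²)² - V²) = 8 κ² V a² + 4 κ² a⁴` because `κ ≥ 1`.
The second-moment bound is carried along since it controls the mixed term. -/
theorem CenteredFamily.linear [IsProbabilityMeasure P] {ι : Type*} {e : ι → Ω → ℝ} {κ : ℝ} (h : CenteredFamily P e κ)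
    (a : ι → ℝ) (s : Finset ι) :
    Integrable (fun ω => (∑ i ∈ s, a i * e i ω) ^ 4) P ∧
    ∫ ω, (∑ i ∈ s, a i * e i ω) ^ 2 ∂P ≤ κ * ∑ i ∈ s, a i ^ 2 ∧
    ∫ ω, (∑ i ∈ s, a i * e i ω) ^ 4 ∂P ≤ 4 * κ ^ 2 * (∑ i ∈ s, a i ^ 2) ^ 2 := by
  classical
  have hm := h.measurable
  induction s using Finset.induction_on with
  | empty => simp
  | insert k s hk ih =>
    obtain ⟨hi, h2, h4⟩ := ih
    set q : Ω → ℝ := fun ω => ∑ i ∈ s, a i * e i ω with hq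
    have hqm : Measurable q := by fun_prop
    have hind : IndepFun (e k) (fun ω => (q ω, a k)) P := by
      refine indepFun_of_notMem (f := fun z => (∑ i ∈ s, a i * z i, a k)) hm h.indep hk
        (by fun_prop) fun z z' hz => ?_
      rw [Finset.sum_congr rfl fun i hi => by rw [hz i hi]]
    obtain ⟨j1, j2, j3⟩ := fourth_moment_step (κ := κ) (hm k) hqm measurable_const hind
      (h.integrable k) hi (integrable_const _) (h.mean k) (h.second k) (h.fourth k)
    have hsum : ∀ ω, ∑ i ∈ insert k s, a i * e i ω = q ω + e k ω * a k := fun ω => by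
      rw [Finset.sum_insert hk]; ring
    simp only [hsum]
    rw [Finset.sum_insert hk]
    set V := ∑ i ∈ s, a i ^ 2 with hV
    have hV0 : 0 ≤ V := Finset.sum_nonneg fun i _ => sq_nonneg _
    have mle : ∀ {f : Ω → ℝ}, Measurable f → Integrable (fun ω => f ω ^ 4) P → MemLp f 2 P := by
      intro f hf hf4
      refine (memLp_two_iff_integrable_sq hf.aestronglyMeasurable).2 ?_
      refine ((integrable_const (1 : ℝ)).add hf4).mono' (by fun_prop) (ae_of_all _ fun ω => ?_)
      rw [Real.norm_eq_abs, Pi.add_apply, abs_of_nonneg (by positivity)]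
      nlinarith [sq_nonneg (f ω ^ 2 - 1)]
    have mq := mle hqm hi
    have mx := mle (hm k) (h.integrable k)
    have ind1 : IndepFun (e k) q P :=
      hind.comp (φ := id) (ψ := fun z : ℝ × ℝ => z.1) measurable_id (by fun_prop)
    have e1 := ind1.integral_fun_mul_eq_mul_integral (by fun_prop) (by fun_prop)
    rw [h.mean k, zero_mul] at e1
    have i1 : Integrable (fun ω => e k ω * q ω) P := mx.integrable_mul mq
    have hκ := h.one_le
    refine ⟨j1, ?_, j3.trans ?_⟩
    · have : ∀ ω, (q ω + e k ω * a k) ^ 2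
          = q ω ^ 2 + 2 * a k * (e k ω * q ω) + a k ^ 2 * e k ω ^ 2 := fun ω => by ring
      simp only [this]
      have iA : Integrable (fun ω => q ω ^ 2 + 2 * a k * (e k ω * q ω)) P :=
        mq.integrable_sq.add (i1.const_mul _)
      rw [integral_add iA (mx.integrable_sq.const_mul _),
        integral_add mq.integrable_sq (i1.const_mul _), integral_const_mul, integral_const_mul, e1]
      nlinarith [h.second k, sq_nonneg (a k)]
    · rw [integral_mul_const]
      simp only [integral_const, probReal_univ, smul_eq_mul, one_mul]
      have ha := sq_nonneg (a k)
      have t1 : κ * (∫ ω, q ω ^ 2 ∂P) * a k ^ 2 ≤ κ * (κ * V) * a k ^ 2 := by gcongr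
      have t2 : κ * a k ^ 4 ≤ κ ^ 2 * a k ^ 4 := by
        refine mul_le_mul_of_nonneg_right ?_ (by positivity)
        nlinarith
      have t3 : 0 ≤ κ ^ 2 * a k ^ 4 := by positivity
      nlinarith

/-- Fourth moment bound for off-diagonal quadratic forms. -/
theorem CenteredFamily.quadratic [IsProbabilityMeasure P] {ι : Type*} [DecidableEq ι] {e : ι → Ω → ℝ} {κ : ℝ}
    (h : CenteredFamily P e κ)
    (A : ι → ι → ℝ) (hA : ∀ i j, A i j = A j i) {τ : ℝ} (s : Finset ι)
    (hτ : ∀ k, ∀ t ⊆ s, ∑ i ∈ t, A i k ^ 2 ≤ τ) :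
    Integrable (fun ω => (∑ i ∈ s, ∑ j ∈ s.erase i, A i j * e i ω * e j ω) ^ 4) P ∧
    ∫ ω, (∑ i ∈ s, ∑ j ∈ s.erase i, A i j * e i ω * e j ω) ^ 4 ∂P
      ≤ 1216 * κ ^ 4 * τ ^ 2 * (s.card : ℝ) ^ 2 := by
  have hm := h.measurable
  induction s using Finset.induction_on with
  | empty => simp
  | insert k s hk ih =>
    obtain ⟨hi, h4⟩ := ih fun k t ht => hτ k t (ht.trans (Finset.subset_insert _ _))
    set q : Ω → ℝ := fun ω => ∑ i ∈ s, ∑ j ∈ s.erase i, A i j * e i ω * e j ω with hq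
    -- Adding the index `k` changes the form by `e k * L`; the factor 2 comes from the symmetry of
    -- `A`.
    set L : Ω → ℝ := fun ω => ∑ i ∈ s, (2 * A i k) * e i ω with hL
    have hqm : Measurable q := by fun_prop
    have hLm : Measurable L := by fun_prop
    obtain ⟨l1, -, l3⟩ := h.linear (fun i => 2 * A i k) s
    have hind : IndepFun (e k) (fun ω => (q ω, L ω)) P := by
      refine indepFun_of_notMem (f := fun z => (∑ i ∈ s, ∑ j ∈ s.erase i, A i j * z i * z j,
        ∑ i ∈ s, (2 * A i k) * z i)) hm h.indep hk (by fun_prop) fun z z' hz => ?_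
      refine Prod.ext (Finset.sum_congr rfl fun i hi => Finset.sum_congr rfl fun j hj => ?_)
        (Finset.sum_congr rfl fun i hi => by rw [hz i hi])
      rw [hz i hi, hz j (Finset.mem_of_mem_erase hj)]
    obtain ⟨j1, j2, j3⟩ := fourth_moment_step (κ := κ) (hm k) hqm hLm hind
      (h.integrable k) hi l1 (h.mean k) (h.second k) (h.fourth k)
    have hsum : ∀ ω, ∑ i ∈ insert k s, ∑ j ∈ (insert k s).erase i, A i j * e i ω * e j ω
        = q ω + e k ω * L ω := fun ω => by
      rw [Finset.sum_insert hk, Finset.erase_insert hk]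
      have h1 : ∀ i ∈ s, ∑ j ∈ (insert k s).erase i, A i j * e i ω * e j ω
          = A i k * e i ω * e k ω + ∑ j ∈ s.erase i, A i j * e i ω * e j ω := by
        intro i hi
        have hik : k ≠ i := fun hh => hk (hh ▸ hi)
        rw [Finset.erase_insert_of_ne hik,
          Finset.sum_insert (fun hh => hk (Finset.mem_of_mem_erase hh))]
      rw [Finset.sum_congr rfl h1, Finset.sum_add_distrib]
      simp only [hq, hL, Finset.mul_sum]
      rw [← add_assoc, ← Finset.sum_add_distrib, add_comm]
      congr 1
      refine Finset.sum_congr rfl fun i _ => ?_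
      rw [hA k i]; ring
    simp only [hsum]
    refine ⟨j1, j3.trans ?_⟩
    rw [Finset.card_insert_of_notMem hk]
    push_cast
    set m : ℝ := (s.card : ℝ) with hmdef
    have hm0 : 0 ≤ m := Nat.cast_nonneg _
    have hκ := h.one_le
    have hb : ∑ i ∈ s, (2 * A i k) ^ 2 ≤ 4 * τ := by
      simp only [mul_pow, ← Finset.mul_sum]
      linarith [hτ k s (Finset.subset_insert _ _)]
    have hb0 : 0 ≤ ∑ i ∈ s, (2 * A i k) ^ 2 := Finset.sum_nonneg fun i _ => sq_nonneg _
    have hL4 : ∫ ω, L ω ^ 4 ∂P ≤ 64 * κ ^ 2 * τ ^ 2 := by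
      refine l3.trans ?_
      have := pow_le_pow_left₀ hb0 hb 2
      calc _ ≤ 4 * κ ^ 2 * (4 * τ) ^ 2 := by gcongr
        _ = _ := by ring
    -- Weighted AM-GM: the weight `1 / (m + 1)` on `q⁴` is small enough for the induction to give
    -- growth `m²` rather than exponential growth.
    have hmix : 8 * κ * ∫ ω, q ω ^ 2 * L ω ^ 2 ∂P
        ≤ (∫ ω, q ω ^ 4 ∂P) / (m + 1) + 16 * κ ^ 2 * (m + 1) * ∫ ω, L ω ^ 4 ∂P := by
      rw [← integral_const_mul, ← integral_div, ← integral_const_mul,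
        ← integral_add (hi.div_const _) (l1.const_mul _)]
      refine integral_mono (j2.const_mul _) ((hi.div_const _).add (l1.const_mul _)) fun ω => ?_
      have hpos : 0 < m + 1 := by linarith
      have : 0 ≤ (q ω ^ 2 - 4 * κ * (m + 1) * L ω ^ 2) ^ 2 / (m + 1) := by positivity
      have heq : (q ω ^ 2 - 4 * κ * (m + 1) * L ω ^ 2) ^ 2 / (m + 1)
          = q ω ^ 4 / (m + 1) + 16 * κ ^ 2 * (m + 1) * L ω ^ 4
            - 8 * κ * (q ω ^ 2 * L ω ^ 2) := by
        field_simp; ring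
      show 8 * κ * (q ω ^ 2 * L ω ^ 2) ≤ q ω ^ 4 / (m + 1) + 16 * κ ^ 2 * (m + 1) * L ω ^ 4
      linarith
    have hq' : (∫ ω, q ω ^ 4 ∂P) / (m + 1) ≤ 1216 * κ ^ 4 * τ ^ 2 * m := by
      rw [div_le_iff₀ (by linarith)]
      refine h4.trans ?_
      have : 0 ≤ 1216 * κ ^ 4 * τ ^ 2 * m := by positivity
      nlinarith
    have hL5 : 16 * κ ^ 2 * (m + 1) * ∫ ω, L ω ^ 4 ∂P ≤ 1024 * κ ^ 4 * τ ^ 2 * (m + 1) := by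
      calc _ ≤ 16 * κ ^ 2 * (m + 1) * (64 * κ ^ 2 * τ ^ 2) := by gcongr
        _ = _ := by ring
    have hL6 : 3 * κ * ∫ ω, L ω ^ 4 ∂P ≤ 192 * κ ^ 4 * τ ^ 2 * (m + 1) := by
      calc _ ≤ 3 * κ * (64 * κ ^ 2 * τ ^ 2) := by gcongr
        _ = 192 * (κ ^ 3 * 1) * τ ^ 2 := by ring
        _ ≤ 192 * (κ ^ 3 * κ) * τ ^ 2 := by gcongr
        _ = 192 * κ ^ 4 * τ ^ 2 * 1 := by ring
        _ ≤ 192 * κ ^ 4 * τ ^ 2 * (m + 1) := by gcongr; linarith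
    -- The constant closes the induction: `1216 = 1024 + 192` collects the two contributions of
    -- `L⁴`, and `(m + 1)² = m² + m + (m + 1)`.
    have : 1216 * κ ^ 4 * τ ^ 2 * (m + 1) ^ 2 = 1216 * κ ^ 4 * τ ^ 2 * m ^ 2
        + 1216 * κ ^ 4 * τ ^ 2 * m + 1216 * κ ^ 4 * τ ^ 2 * (m + 1) := by ring
    linarith

end Moments

/-! ### Moments of order `2 + δ` -/

theorem abs_rpow_sub_one_le {t δ : ℝ} (ht : 0 ≤ t) (hδ : 0 < δ) (hδ1 : δ ≤ 1) :
    |t ^ δ - 1| ≤ |t - 1| := by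
  rcases le_total 1 t with h | h
  · have h1 := Real.one_le_rpow h hδ.le
    have h2 := Real.rpow_le_rpow_of_exponent_le h hδ1
    rw [Real.rpow_one] at h2
    rw [abs_of_nonneg (by linarith), abs_of_nonneg (by linarith)]
    linarith
  · have h1 := Real.rpow_le_one ht h hδ.le
    have h2 : t ≤ t ^ δ := by
      rcases ht.eq_or_lt with h0 | h0
      · rw [← h0, Real.zero_rpow hδ.ne']
      · simpa using Real.rpow_le_rpow_of_exponent_ge h0 h hδ1
    rw [abs_of_nonpos (by linarith), abs_of_nonpos (by linarith)]
    linarith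

/-- Divide by `w` and apply the case `w = 1`. It bounds the increments of `t ↦ t |t| ^ δ` in
`abs_add_rpow_le` without differentiation. -/
theorem mul_abs_rpow_sub_rpow_le {u w δ : ℝ} (hu : 0 ≤ u) (hw : 0 ≤ w) (hδ : 0 < δ)
    (hδ1 : δ ≤ 1) : w * |u ^ δ - w ^ δ| ≤ w ^ δ * |u - w| := by
  rcases hw.eq_or_lt with h0 | h0
  · rw [← h0]; simp; positivity
  · have h := abs_rpow_sub_one_le (div_nonneg hu hw) hδ hδ1
    rw [Real.div_rpow hu hw] at h
    have hwδ : 0 < w ^ δ := Real.rpow_pos_of_pos h0 δ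
    have e1 : u ^ δ - w ^ δ = w ^ δ * (u ^ δ / w ^ δ - 1) := by field_simp
    have e2 : u - w = w * (u / w - 1) := by field_simp
    rw [e1, e2, abs_mul, abs_mul, abs_of_pos hwδ, abs_of_pos h0]
    calc _ = w ^ δ * w * |u ^ δ / w ^ δ - 1| := by ring
      _ ≤ w ^ δ * w * |u / w - 1| := by gcongr
      _ = _ := by ring

theorem abs_rpow_two_add (x δ : ℝ) (hδ : 0 < δ) : |x| ^ (2 + δ) = x ^ 2 * |x| ^ δ := by
  rw [Real.rpow_add_of_nonneg (abs_nonneg x) (by norm_num) hδ.le]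
  norm_num

/-- Convexity of `|·| ^ (2 + δ)`, in the form of Young's inequality, gives the tangent bound at `c =
a + b` with slope `(2 + δ) c |c|^δ`. Moving the slope from `c` to `a` costs `b² (|c|^δ + |a|^δ)`,
and `|c|^δ ≤ |a|^δ + |b|^δ`. The slope must sit at `a` so that the linear term has mean zero when
`b` is centred and independent of `a`. -/
theorem abs_add_rpow_le (a b : ℝ) {δ : ℝ} (hδ : 0 < δ) (hδ1 : δ ≤ 1) :
    |a + b| ^ (2 + δ) ≤ |a| ^ (2 + δ) + (2 + δ) * (b * (a * |a| ^ δ))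
      + (2 + δ) * (2 * (b ^ 2 * |a| ^ δ) + |b| ^ (2 + δ)) := by
  set c := a + b with hc
  have hcδ : 0 ≤ |c| ^ δ := by positivity
  have young : (2 + δ) * (c * |c| ^ δ * a) ≤ |a| ^ (2 + δ) + (1 + δ) * |c| ^ (2 + δ) := by
    have hpq : (2 + δ).HolderConjugate ((2 + δ) / (1 + δ)) := by
      rw [Real.holderConjugate_iff]
      refine ⟨by linarith, ?_⟩
      field_simp
      ring
    have h := Real.young_inequality_of_nonneg (abs_nonneg a)
      (Real.rpow_nonneg (abs_nonneg c) (1 + δ)) hpq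
    rw [← Real.rpow_mul (abs_nonneg c), mul_div_cancel₀ _ (by linarith : (1 + δ) ≠ 0)] at h
    have h1 : c * |c| ^ δ * a ≤ |a| * |c| ^ (1 + δ) := by
      rw [Real.rpow_add_of_nonneg (abs_nonneg c) (by norm_num) hδ.le, Real.rpow_one]
      calc c * |c| ^ δ * a = (c * a) * |c| ^ δ := by ring
        _ ≤ |c * a| * |c| ^ δ := by gcongr; exact le_abs_self _
        _ = _ := by rw [abs_mul]; ring
    have h2 := mul_le_mul_of_nonneg_left (h1.trans h) (by linarith : (0:ℝ) ≤ 2 + δ)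
    refine h2.trans (le_of_eq ?_)
    field_simp
  have tang : |c| ^ (2 + δ) ≤ |a| ^ (2 + δ) + (2 + δ) * (c * |c| ^ δ * b) := by
    have : c * |c| ^ δ * a = |c| ^ (2 + δ) - c * |c| ^ δ * b := by
      rw [abs_rpow_two_add c δ hδ, hc]; ring
    rw [this] at young
    linarith
  have lip : (c * |c| ^ δ - a * |a| ^ δ) * b ≤ b ^ 2 * (|c| ^ δ + |a| ^ δ) := by
    have h1 : a * (|c| ^ δ - |a| ^ δ) * b ≤ |a| ^ δ * b ^ 2 := by
      calc _ ≤ |a * (|c| ^ δ - |a| ^ δ) * b| := le_abs_self _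
        _ = (|a| * |(|c| ^ δ - |a| ^ δ)|) * |b| := by rw [abs_mul, abs_mul]
        _ ≤ (|a| ^ δ * |(|c| - |a|)|) * |b| := by
            gcongr ?_ * _
            exact mul_abs_rpow_sub_rpow_le (abs_nonneg c) (abs_nonneg a) hδ hδ1
        _ ≤ (|a| ^ δ * |b|) * |b| := by
            have : |(|c| - |a|)| ≤ |b| := by
              simpa [hc] using abs_abs_sub_abs_le_abs_sub c a
            gcongr
        _ = |a| ^ δ * b ^ 2 := by rw [mul_assoc, abs_mul_abs_self, pow_two]
    have h2 : (c * |c| ^ δ - a * |a| ^ δ) * b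
        = b ^ 2 * |c| ^ δ + a * (|c| ^ δ - |a| ^ δ) * b := by rw [hc]; ring
    rw [h2]; linarith
  have sub : |c| ^ δ ≤ |a| ^ δ + |b| ^ δ :=
    (Real.rpow_le_rpow (abs_nonneg _) (abs_add_le a b) hδ.le).trans
      (Real.rpow_add_le_add_rpow (abs_nonneg a) (abs_nonneg b) hδ.le hδ1)
  have h3 := mul_le_mul_of_nonneg_left sub (sq_nonneg b)
  rw [abs_rpow_two_add b δ hδ]
  have h4 : (c * |c| ^ δ) * b ≤ b * (a * |a| ^ δ) + b ^ 2 * (2 * |a| ^ δ + |b| ^ δ) := by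
    linarith
  have h5 := mul_le_mul_of_nonneg_left h4 (by linarith : (0:ℝ) ≤ 2 + δ)
  linarith

theorem rpow_le_one_add_rpow {t a b : ℝ} (ht : 0 ≤ t) (ha : 0 ≤ a) (hab : a ≤ b) :
    t ^ a ≤ 1 + t ^ b := by
  have hb : 0 ≤ t ^ b := Real.rpow_nonneg ht b
  rcases le_total t 1 with h | h
  · linarith [Real.rpow_le_one ht h ha]
  · linarith [Real.rpow_le_rpow_of_exponent_le h hab]

section Moments

variable {Ω : Type*} [MeasurableSpace Ω] {P : Measure Ω} [IsProbabilityMeasure P]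

/-- A moment inequality of order `2 + δ` for sums of independent centred variables. -/
theorem sum_abs_moment_le {ι : Type*} {e : ι → Ω → ℝ} {δ v M N : ℝ} (hδ : 0 < δ)
    (hδ1 : δ ≤ 1) (hm : ∀ i, Measurable (e i)) (hind : iIndepFun e P)
    (hi : ∀ i, Integrable (fun ω => |e i ω| ^ (2 + δ)) P) (h0 : ∀ i, ∫ ω, e i ω ∂P = 0)
    (h2 : ∀ i, ∫ ω, e i ω ^ 2 ∂P ≤ v) (hM : ∀ i, ∫ ω, |e i ω| ^ (2 + δ) ∂P ≤ M)
    (hv : 0 ≤ v) (hM0 : 0 ≤ M) (hN : 1 ≤ N) (s : Finset ι) (hs : (s.card : ℝ) ≤ N) :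
    Integrable (fun ω => |∑ i ∈ s, e i ω| ^ (2 + δ)) P ∧
    ∫ ω, (∑ i ∈ s, e i ω) ^ 2 ∂P ≤ s.card * v ∧
    ∫ ω, |∑ i ∈ s, e i ω| ^ (2 + δ) ∂P
      ≤ s.card * ((2 + δ) * (2 * (1 + v) * v + M) * N ^ (δ / 2)) := by
  classical
  induction s using Finset.induction_on with
  | empty => simp [Real.zero_rpow (by linarith : 2 + δ ≠ 0)]
  | insert k s hk ih =>
    rw [Finset.card_insert_of_notMem hk] at hs ⊢
    push_cast at hs ⊢
    obtain ⟨iS, S2, Sq⟩ := ih (by linarith)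
    simp only [Finset.sum_insert hk]
    set S : Ω → ℝ := fun ω => ∑ i ∈ s, e i ω with hS
    have hSm : Measurable S := by fun_prop
    have hind1 : IndepFun (e k) S P :=
      indepFun_of_notMem (f := fun z => ∑ i ∈ s, z i) hm hind hk (by fun_prop)
        fun z z' hz => Finset.sum_congr rfl fun i hi => hz i hi
    have mle : ∀ {f : Ω → ℝ} {a : ℝ}, 0 ≤ a → a ≤ 2 + δ → Measurable f →
        Integrable (fun ω => |f ω| ^ (2 + δ)) P → Integrable (fun ω => |f ω| ^ a) P := by
      intro f a ha ha' hf hfi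
      refine ((integrable_const (1 : ℝ)).add hfi).mono' (by fun_prop) (ae_of_all _ fun ω => ?_)
      rw [Real.norm_eq_abs, Pi.add_apply, abs_of_nonneg (by positivity)]
      exact rpow_le_one_add_rpow (abs_nonneg _) ha ha'
    have mL2 : ∀ {f : Ω → ℝ}, Measurable f → Integrable (fun ω => |f ω| ^ (2 + δ)) P →
        MemLp f 2 P := by
      intro f hf hfi
      refine (memLp_two_iff_integrable_sq hf.aestronglyMeasurable).2 ?_
      have := mle (a := 2) (by norm_num) (by linarith) hf hfi
      simpa using this
    have mS := mL2 hSm iS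
    have mb := mL2 (hm k) (hi k)
    have iSb : Integrable (fun ω => e k ω * S ω) P := mb.integrable_mul mS
    have eSb := hind1.integral_fun_mul_eq_mul_integral (by fun_prop) (by fun_prop)
    rw [h0 k, zero_mul] at eSb
    have iSδ : Integrable (fun ω => |S ω| ^ δ) P := mle hδ.le (by linarith) hSm iS
    have iSδ1 : Integrable (fun ω => S ω * |S ω| ^ δ) P := by
      refine (mle (a := 1 + δ) (by linarith) (by linarith) hSm iS).mono' (by fun_prop)
        (ae_of_all _ fun ω => le_of_eq ?_)
      rw [Real.norm_eq_abs, abs_mul, abs_of_nonneg (by positivity : 0 ≤ |S ω| ^ δ),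
        Real.rpow_add_of_nonneg (abs_nonneg _) (by norm_num) hδ.le, Real.rpow_one]
    have ib : Integrable (e k) P := mb.integrable (by norm_num)
    have ind3 : IndepFun (e k) (fun ω => S ω * |S ω| ^ δ) P :=
      hind1.comp (φ := id) (ψ := fun t : ℝ => t * |t| ^ δ) measurable_id (by fun_prop)
    have i3 : Integrable (fun ω => e k ω * (S ω * |S ω| ^ δ)) P := ind3.integrable_mul ib iSδ1
    have e3 := ind3.integral_fun_mul_eq_mul_integral (by fun_prop) (by fun_prop)
    rw [h0 k, zero_mul] at e3
    have ind4 : IndepFun (fun ω => e k ω ^ 2) (fun ω => |S ω| ^ δ) P :=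
      hind1.comp (φ := fun t => t ^ 2) (ψ := fun t : ℝ => |t| ^ δ) (by fun_prop) (by fun_prop)
    have i4 : Integrable (fun ω => e k ω ^ 2 * |S ω| ^ δ) P :=
      ind4.integrable_mul mb.integrable_sq iSδ
    have e4 := ind4.integral_fun_mul_eq_mul_integral (by fun_prop)
      (hSm.abs.pow_const δ).aestronglyMeasurable
    have key : ∀ ω, |e k ω + S ω| ^ (2 + δ) ≤ |S ω| ^ (2 + δ)
        + (2 + δ) * (e k ω * (S ω * |S ω| ^ δ))
        + (2 + δ) * (2 * (e k ω ^ 2 * |S ω| ^ δ) + |e k ω| ^ (2 + δ)) := by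
      intro ω
      rw [add_comm (e k ω)]
      exact abs_add_rpow_le _ _ hδ hδ1
    have iA : Integrable (fun ω => |S ω| ^ (2 + δ) + (2 + δ) * (e k ω * (S ω * |S ω| ^ δ))) P :=
      iS.add (i3.const_mul _)
    have iB : Integrable (fun ω => 2 * (e k ω ^ 2 * |S ω| ^ δ) + |e k ω| ^ (2 + δ)) P :=
      (i4.const_mul 2).add (hi k)
    have iR : Integrable (fun ω => |S ω| ^ (2 + δ) + (2 + δ) * (e k ω * (S ω * |S ω| ^ δ))
        + (2 + δ) * (2 * (e k ω ^ 2 * |S ω| ^ δ) + |e k ω| ^ (2 + δ))) P :=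
      iA.add (iB.const_mul _)
    have iL : Integrable (fun ω => |e k ω + S ω| ^ (2 + δ)) P := by
      refine iR.mono' (((hm k).add hSm).abs.pow_const _).aestronglyMeasurable (ae_of_all _ fun ω => ?_)
      rw [Real.norm_eq_abs, abs_of_nonneg (by positivity)]
      exact key ω
    refine ⟨iL, ?_, (integral_mono iL iR key).trans ?_⟩
    · have : ∀ ω, (e k ω + S ω) ^ 2 = S ω ^ 2 + 2 * (e k ω * S ω) + e k ω ^ 2 :=
        fun ω => by ring
      refine (le_of_eq (integral_congr_ae (ae_of_all _ this))).trans ?_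
      have iC : Integrable (fun ω => S ω ^ 2 + 2 * (e k ω * S ω)) P :=
        mS.integrable_sq.add (iSb.const_mul _)
      rw [integral_add iC mb.integrable_sq, integral_add mS.integrable_sq (iSb.const_mul _),
        integral_const_mul, eSb]
      linarith [h2 k]
    · rw [integral_add iA (iB.const_mul _), integral_add iS (i3.const_mul _), integral_const_mul,
        integral_const_mul, e3, integral_add (i4.const_mul 2) (hi k), integral_const_mul, e4]
      have hNpos : 0 < N := by linarith
      have hNδ : 1 ≤ N ^ (δ / 2) := Real.one_le_rpow hN (by linarith)
      -- Since `δ ≤ 2`, compare `|S| / √N` with its square and use the inductive second moment. The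
      -- fixed `N`, rather than the current cardinality, makes every increment obey the same bound.
      have hSδ : ∫ ω, |S ω| ^ δ ∂P ≤ N ^ (δ / 2) * (1 + v) := by
        have hb : ∀ ω, |S ω| ^ δ ≤ N ^ (δ / 2) * (1 + S ω ^ 2 / N) := by
          intro ω
          have h := rpow_le_one_add_rpow (t := |S ω| / √N) (a := δ) (b := 2) (by positivity)
            hδ.le (by linarith)
          have e1 : (|S ω| / √N) ^ (2 : ℝ) = S ω ^ 2 / N := by
            rw [Real.rpow_two, div_pow, sq_abs, Real.sq_sqrt hNpos.le]
          have e2 : (|S ω| / √N) ^ δ = |S ω| ^ δ / N ^ (δ / 2) := by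
            rw [Real.div_rpow (abs_nonneg _) (Real.sqrt_nonneg _), Real.sqrt_eq_rpow,
              ← Real.rpow_mul hNpos.le]
            congr 2; ring
          rw [e1, e2, div_le_iff₀ (by linarith)] at h
          linarith
        refine (integral_mono iSδ (((integrable_const _).add
          (mS.integrable_sq.div_const N)).const_mul _) hb).trans ?_
        rw [integral_const_mul]
        refine mul_le_mul_of_nonneg_left ?_ (by linarith)
        have : ∫ ω, (1 + S ω ^ 2 / N) ∂P = 1 + (∫ ω, S ω ^ 2 ∂P) / N := by
          rw [integral_add (integrable_const _) (mS.integrable_sq.div_const N), integral_div]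
          simp
        refine (le_of_eq this).trans ?_
        have h7 : (∫ ω, S ω ^ 2 ∂P) / N ≤ v := by
          rw [div_le_iff₀ hNpos]
          have : (s.card : ℝ) * v ≤ N * v := by gcongr; linarith
          linarith
        linarith
      have hSδ0 : 0 ≤ ∫ ω, |S ω| ^ δ ∂P := integral_nonneg fun ω => by positivity
      have t1 : (∫ ω, e k ω ^ 2 ∂P) * ∫ ω, |S ω| ^ δ ∂P ≤ v * (N ^ (δ / 2) * (1 + v)) := by
        have := h2 k
        gcongr
      have t2 : ∫ ω, |e k ω| ^ (2 + δ) ∂P ≤ M * N ^ (δ / 2) :=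
        (hM k).trans (le_mul_of_one_le_right hM0 hNδ)
      have t3 := mul_le_mul_of_nonneg_left (add_le_add (mul_le_mul_of_nonneg_left t1
        (by norm_num : (0:ℝ) ≤ 2)) t2) (by linarith : (0:ℝ) ≤ 2 + δ)
      linarith

end Moments

/-! ### Measurability of the resolvent and the signal form -/

instance matrixBorelSpace {n p : ℕ} : BorelSpace (Matrix (Fin n) (Fin p) ℝ) :=
  inferInstanceAs (BorelSpace (Fin n → Fin p → ℝ))

instance matrixSecondCountable {n p : ℕ} : SecondCountableTopology (Matrix (Fin n) (Fin p) ℝ) :=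
  inferInstanceAs (SecondCountableTopology (Fin n → Fin p → ℝ))

/-- The inverse is adjugate over determinant, and for `lam > 0` the determinant never vanishes.
Continuity supplies the joint measurability needed for Fubini. -/
theorem continuous_resolvent {n p : ℕ} {lam : ℝ} (hlam : 0 < lam) :
    Continuous (fun X : Matrix (Fin n) (Fin p) ℝ => resolvent X lam) := by
  have hK : Continuous fun X : Matrix (Fin n) (Fin p) ℝ =>
      X * Xᵀ + lam • (1 : Matrix (Fin n) (Fin n) ℝ) := by fun_prop
  simp only [resolvent, Matrix.inv_def, Ring.inverse_eq_inv']
  exact (hK.matrix_det.inv₀ fun X => (isUnit_det_mul_transpose_add X hlam).ne_zero).smul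
    hK.matrix_adjugate

theorem continuous_signalMatrix {n p : ℕ} {lam : ℝ} (hlam : 0 < lam) :
    Continuous (fun X : Matrix (Fin n) (Fin p) ℝ => signalMatrix X lam) := by
  have := continuous_resolvent (n := n) (p := p) hlam
  unfold signalMatrix
  fun_prop

theorem continuous_signalForm {n p : ℕ} {lam : ℝ} (hlam : 0 < lam) :
    Continuous (fun z : Matrix (Fin n) (Fin p) ℝ × (Fin p → ℝ) => signalForm z.1 lam z.2) := by
  have h := (continuous_signalMatrix (n := n) (p := p) hlam).comp
    (continuous_fst (Y := Fin p → ℝ))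
  have h' : Continuous fun z : Matrix (Fin n) (Fin p) ℝ × (Fin p → ℝ) =>
    signalMatrix z.1 lam := h
  unfold signalForm
  refine (Continuous.dotProduct continuous_snd (h'.matrix_mulVec continuous_snd)).sub
    ((h'.matrix_trace.div_const _).mul (Continuous.dotProduct continuous_snd continuous_snd))

/-! ### Almost sure convergence from summable moments -/

section Convergence

variable {Ω : Type*} [MeasurableSpace Ω] {P : Measure Ω}

/-- The series of `|f n| ^ q` has finite integral past some index, so it converges almost everywhere
and its terms tend to zero. This replaces Markov plus Borel–Cantelli. -/
theorem ae_tendsto_zero_of_moment_le {f : ℕ → Ω → ℝ} (hf : ∀ n, Measurable (f n)) {q s C : ℝ}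
    (hq : 0 < q) (hs : 1 < s)
    (h : ∀ᶠ n : ℕ in atTop,
      ∫⁻ ω, ENNReal.ofReal (|f n ω| ^ q) ∂P ≤ ENNReal.ofReal (C * (n : ℝ) ^ (-s))) :
    ∀ᵐ ω ∂P, Tendsto (fun n => f n ω) atTop (𝓝 0) := by
  obtain ⟨N, hN⟩ := eventually_atTop.1 h
  have hsum : Summable fun n : ℕ => |C| * ((n + N : ℕ) : ℝ) ^ (-s) :=
    ((summable_nat_add_iff N).2 (Real.summable_nat_rpow.2 (by linarith : -s < -1))).mul_left _
  have hgm : ∀ n, Measurable fun ω => ENNReal.ofReal (|f (n + N) ω| ^ q) := fun n =>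
    ((hf _).abs.pow_const q).ennreal_ofReal
  have hfin : ∫⁻ ω, ∑' n, ENNReal.ofReal (|f (n + N) ω| ^ q) ∂P ≠ ⊤ := by
    rw [lintegral_tsum fun n => (hgm n).aemeasurable]
    refine ne_top_of_le_ne_top hsum.tsum_ofReal_ne_top (ENNReal.tsum_le_tsum fun n => ?_)
    refine (hN (n + N) (Nat.le_add_left _ _)).trans (ENNReal.ofReal_le_ofReal ?_)
    exact mul_le_mul_of_nonneg_right (le_abs_self C) (by positivity)
  filter_upwards [ae_lt_top' (Measurable.tsum hgm).aemeasurable hfin] with ω hω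
  have h1 := ENNReal.tendsto_atTop_zero_of_tsum_ne_top hω.ne
  have h2 : Tendsto (fun n => |f (n + N) ω| ^ q) atTop (𝓝 0) := by
    have := (ENNReal.tendsto_toReal ENNReal.zero_ne_top).comp h1
    refine this.congr fun n => ?_
    exact ENNReal.toReal_ofReal (by positivity)
  have h3 : Tendsto (fun n => |f (n + N) ω|) atTop (𝓝 0) := by
    have := h2.rpow_const (p := q⁻¹) (Or.inr (by positivity))
    rw [Real.zero_rpow (by positivity)] at this
    refine this.congr fun n => ?_
    rw [← Real.rpow_mul (abs_nonneg _), mul_inv_cancel₀ hq.ne', Real.rpow_one]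
  exact (tendsto_add_atTop_iff_nat N).1 ((tendsto_zero_iff_abs_tendsto_zero _).2 h3)

/-- Independence makes the joint law a product, so by Tonelli `V` can be frozen while the moment
over `U` is estimated. -/
theorem lintegral_le_of_indepFun [IsProbabilityMeasure P] {α β : Type*} [MeasurableSpace α]
    [MeasurableSpace β] {U : Ω → α} {V : Ω → β} (hU : Measurable U) (hV : Measurable V)
    (hind : IndepFun U V P) {F : α × β → ENNReal} (hF : Measurable F) {B : ENNReal}
    (h : ∀ᵐ ω ∂P, ∫⁻ ω', F (U ω', V ω) ∂P ≤ B) : ∫⁻ ω, F (U ω, V ω) ∂P ≤ B := by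
  have hmap := (indepFun_iff_map_prod_eq_prod_map_map hU.aemeasurable hV.aemeasurable).1 hind
  have : IsProbabilityMeasure (P.map U) := Measure.isProbabilityMeasure_map hU.aemeasurable
  have : IsProbabilityMeasure (P.map V) := Measure.isProbabilityMeasure_map hV.aemeasurable
  have e1 : ∫⁻ ω, F (U ω, V ω) ∂P = ∫⁻ z, F z ∂(P.map fun ω => (U ω, V ω)) :=
    (lintegral_map hF (hU.prodMk hV)).symm
  rw [e1, hmap, lintegral_prod_symm _ hF.aemeasurable,
    lintegral_map hF.lintegral_prod_left' hV]
  have e2 : ∀ ω, ∫⁻ x, F (x, V ω) ∂(P.map U) = ∫⁻ ω', F (U ω', V ω) ∂P := fun ω =>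
    lintegral_map (hF.comp (by fun_prop)) hU
  simp only [e2]
  calc _ ≤ ∫⁻ _, B ∂P := lintegral_mono_ae h
    _ = B := by simp

theorem lintegral_ofReal_le {f : Ω → ℝ} {c : ℝ} (hf : Integrable f P) (h0 : ∀ ω, 0 ≤ f ω)
    (h : ∫ ω, f ω ∂P ≤ c) : ∫⁻ ω, ENNReal.ofReal (f ω) ∂P ≤ ENNReal.ofReal c := by
  rw [← ofReal_integral_eq_lintegral_ofReal hf (ae_of_all _ h0)]
  exact ENNReal.ofReal_le_ofReal h

end Convergence

/-! ### Random signs and the fourth moment of the signal form -/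

/-- The uniform distribution on `{1, -1}`. -/
def rademacher : Measure ℝ :=
  (2 : ENNReal)⁻¹ • Measure.dirac 1 + (2 : ENNReal)⁻¹ • Measure.dirac (-1)

instance isProbabilityMeasure_rademacher : IsProbabilityMeasure rademacher :=
  ⟨by simp [rademacher, ENNReal.inv_two_add_inv_two]⟩

theorem integrable_rademacher (f : ℝ → ℝ) : Integrable f rademacher := by
  refine Integrable.add_measure ?_ ?_ <;>
  exact (integrable_dirac (by simp)).smul_measure (by simp)

theorem integral_rademacher (f : ℝ → ℝ) : ∫ x, f x ∂rademacher = (f 1 + f (-1)) / 2 := by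
  have h : ∀ a : ℝ, Integrable f ((2 : ENNReal)⁻¹ • Measure.dirac a) := fun a =>
    (integrable_dirac (by simp)).smul_measure (by simp)
  rw [rademacher, integral_add_measure (h _) (h _)]
  simp
  ring

theorem ae_rademacher_sq : ∀ᵐ x ∂rademacher, x ^ 2 = 1 := by
  have h : MeasurableSet {x : ℝ | x ^ 2 = 1} := measurableSet_eq_fun (by fun_prop) (by fun_prop)
  rw [rademacher, ae_add_measure_iff]
  constructor <;> refine Measure.ae_smul_measure ?_ _ <;> rw [ae_dirac_iff h] <;> norm_num

/-- The law of `p` independent random signs. -/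
def signs (p : ℕ) : Measure (Fin p → ℝ) := Measure.pi fun _ => rademacher

instance isProbabilityMeasure_signs (p : ℕ) : IsProbabilityMeasure (signs p) := by
  unfold signs; infer_instance

theorem measurePreserving_eval_signs {p : ℕ} (i : Fin p) :
    MeasurePreserving (fun z : Fin p → ℝ => z i) (signs p) rademacher :=
  measurePreserving_eval _ i

theorem integral_signs {p : ℕ} (i : Fin p) (f : ℝ → ℝ) (hf : Measurable f) :
    ∫ z, f (z i) ∂(signs p) = (f 1 + f (-1)) / 2 := by
  rw [← integral_rademacher, ← (measurePreserving_eval_signs i).map_eq,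
    integral_map (measurePreserving_eval_signs i).measurable.aemeasurable hf.aestronglyMeasurable]

theorem iIndepFun_signs (p : ℕ) : iIndepFun (fun (i : Fin p) (z : Fin p → ℝ) => z i) (signs p) :=
  iIndepFun_pi (X := fun _ => id) (fun _ => aemeasurable_id)

theorem ae_signs_sq (p : ℕ) : ∀ᵐ z ∂(signs p), ∀ i, z i ^ 2 = 1 :=
  ae_all_iff.2 fun i => (measurePreserving_eval_signs i).quasiMeasurePreserving.ae ae_rademacher_sq

theorem centeredFamily_signs (p : ℕ) :
    CenteredFamily (signs p) (fun (i : Fin p) (z : Fin p → ℝ) => z i) 1 where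
  measurable i := by fun_prop
  indep := iIndepFun_signs p
  integrable i := (measurePreserving_eval_signs i).integrable_comp_of_integrable
    (g := fun x : ℝ => x ^ 4) (integrable_rademacher _)
  mean i := by rw [integral_signs i (fun x => x) (by fun_prop)]; norm_num
  second i := by rw [integral_signs i (fun x => x ^ 2) (by fun_prop)]; norm_num
  fourth i := by rw [integral_signs i (fun x => x ^ 4) (by fun_prop)]; norm_num
  one_le := le_rfl

theorem dotProduct_mulVec_eq_offDiag_add {m : ℕ} (B : Matrix (Fin m) (Fin m) ℝ) (g : Fin m → ℝ) :
    g ⬝ᵥ (B *ᵥ g) = ∑ i, ∑ j ∈ Finset.univ.erase i, B i j * g i * g j + ∑ i, B i i * g i ^ 2 := by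
  rw [← Finset.sum_add_distrib]
  simp only [dotProduct, Matrix.mulVec, Finset.mul_sum]
  refine Finset.sum_congr rfl fun i _ => ?_
  rw [← Finset.sum_erase_add _ _ (Finset.mem_univ i)]
  congr 1
  · exact Finset.sum_congr rfl fun j _ => by ring
  · ring

section SignalMoment

variable {Ω : Type*} [MeasurableSpace Ω] {P : Measure Ω}

/-- For a sign vector the diagonal part of `gᵀ B g` equals `tr B = (tr B / p) gᵀ g` exactly, so
centring leaves only the off-diagonal form. This is the advantage of signs over Gaussian or
spherical vectors. -/
theorem lintegral_signalForm_signs_le {n p : ℕ} (hp : p ≠ 0) (X : Matrix (Fin n) (Fin p) ℝ)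
    {lam : ℝ} (hlam : 0 < lam) :
    ∫⁻ g, ENNReal.ofReal (signalForm X lam g ^ 4) ∂(signs p)
      ≤ ENNReal.ofReal (1216 * ((1 / lam) ^ 2) ^ 2 * (p : ℝ) ^ 2) := by
  set B := signalMatrix X lam with hB
  have hsymm : ∀ i j, B i j = B j i := fun i j => by
    conv_lhs => rw [hB, ← signalMatrix_transpose]
    rfl
  have h := (centeredFamily_signs p).quadratic (fun i j => B i j) hsymm Finset.univ
    (τ := (1 / lam) ^ 2) fun k t _ => (Finset.sum_le_univ_sum_of_nonneg
      fun i => sq_nonneg _).trans (sum_sq_col_signalMatrix X hlam k)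
  have hp' : (p : ℝ) ≠ 0 := by exact_mod_cast hp
  have heq : ∀ᵐ g ∂(signs p), ENNReal.ofReal (signalForm X lam g ^ 4)
      = ENNReal.ofReal ((∑ i, ∑ j ∈ Finset.univ.erase i, B i j * g i * g j) ^ 4) := by
    filter_upwards [ae_signs_sq p] with g hg
    have hgg : g ⬝ᵥ g = p := by simp [dotProduct, ← pow_two, hg]
    rw [signalForm, dotProduct_mulVec_eq_offDiag_add, hgg, div_mul_cancel₀ _ hp']
    simp [hg, Matrix.trace, ← hB]
  rw [lintegral_congr_ae heq]
  refine lintegral_ofReal_le h.1 (fun ω => by positivity) (h.2.trans (le_of_eq ?_))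
  simp

/-- By invariance the moment is a function of `‖b‖` alone, so it is unchanged when `b` is replaced
by a sign vector scaled to the same norm. Averaging over the signs and exchanging integrals reduces
it to a fixed design with random signs. -/
theorem lintegral_signalForm_le [IsProbabilityMeasure P] {n p : ℕ} (hp : p ≠ 0)
    {X : Ω → Matrix (Fin n) (Fin p) ℝ} (hX : Measurable X)
    (hinv : RightRotationallyInvariant P X) {lam : ℝ} (hlam : 0 < lam) (b : Fin p → ℝ) :
    ∫⁻ ω, ENNReal.ofReal (signalForm (X ω) lam b ^ 4) ∂P
      ≤ ENNReal.ofReal (1216 * (1 / lam) ^ 4 * (b ⬝ᵥ b) ^ 4 / (p : ℝ) ^ 2) := by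
  have hp' : (p : ℝ) ≠ 0 := by exact_mod_cast hp
  have hcont := continuous_signalForm (n := n) (p := p) hlam
  set Φ : (Fin p → ℝ) → ENNReal :=
    fun b => ∫⁻ ω, ENNReal.ofReal (signalForm (X ω) lam b ^ 4) ∂P with hΦ
  have hmX : ∀ b, Measurable fun Y : Matrix (Fin n) (Fin p) ℝ =>
      ENNReal.ofReal (signalForm Y lam b ^ 4) := fun b =>
    ((hcont.measurable.comp (by fun_prop : Measurable fun Y => (Y, b))).pow_const 4).ennreal_ofReal
  have hrot : ∀ O ∈ Matrix.orthogonalGroup (Fin p) ℝ, ∀ b, Φ (O *ᵥ b) = Φ b := by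
    intro O hO b
    have hXO : Measurable fun ω => X ω * O :=
      (continuous_id.matrix_mul continuous_const).measurable.comp hX
    simp only [hΦ, ← signalForm_mul_orthogonal _ hO]
    rw [← lintegral_map (hmX b) hXO, hinv O hO, lintegral_map (hmX b) hX]
  set c := √((b ⬝ᵥ b) / p) with hc
  have hc2 : c ^ 2 = (b ⬝ᵥ b) / p :=
    Real.sq_sqrt (div_nonneg (dotProduct_self_nonneg' b) (Nat.cast_nonneg _))
  -- A rotation carries `c • g` to `b`; the power `c ^ 8` is the fourth power of a form of degree
  -- two.
  have hg : ∀ᵐ g ∂(signs p), Φ b = ENNReal.ofReal (c ^ 8) * Φ g := by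
    filter_upwards [ae_signs_sq p] with g hg
    have hgg : g ⬝ᵥ g = p := by simp [dotProduct, ← pow_two, hg]
    have hcg : (c • g) ⬝ᵥ (c • g) = b ⬝ᵥ b := by
      rw [smul_dotProduct, dotProduct_smul, hgg, smul_eq_mul, smul_eq_mul, ← mul_assoc,
        ← pow_two, hc2, div_mul_cancel₀ _ hp']
    obtain ⟨O, hO, hOb⟩ := exists_orthogonal_mulVec_eq hcg
    rw [← hOb, hrot O hO]
    simp only [hΦ, signalForm_smul]
    have hm : Measurable fun ω => ENNReal.ofReal (signalForm (X ω) lam g ^ 4) := (hmX g).comp hX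
    rw [← lintegral_const_mul _ hm]
    refine lintegral_congr fun ω => ?_
    rw [← ENNReal.ofReal_mul (by positivity)]
    congr 1; ring
  have hjoint : Measurable fun z : (Fin p → ℝ) × Ω =>
      ENNReal.ofReal (signalForm (X z.2) lam z.1 ^ 4) :=
    ((hcont.measurable.comp (by fun_prop : Measurable fun z : (Fin p → ℝ) × Ω =>
      (X z.2, z.1))).pow_const 4).ennreal_ofReal
  calc Φ b = ∫⁻ _, Φ b ∂(signs p) := by simp
    _ = ∫⁻ g, ENNReal.ofReal (c ^ 8) * Φ g ∂(signs p) := lintegral_congr_ae hg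
    _ = ENNReal.ofReal (c ^ 8) * ∫⁻ g, Φ g ∂(signs p) :=
        lintegral_const_mul _ hjoint.lintegral_prod_right'
    _ = ENNReal.ofReal (c ^ 8)
          * ∫⁻ ω, ∫⁻ g, ENNReal.ofReal (signalForm (X ω) lam g ^ 4) ∂(signs p) ∂P := by
        rw [hΦ, lintegral_lintegral_swap hjoint.aemeasurable]
    _ ≤ ENNReal.ofReal (c ^ 8)
          * ∫⁻ _, ENNReal.ofReal (1216 * ((1 / lam) ^ 2) ^ 2 * (p : ℝ) ^ 2) ∂P := by
        gcongr with ω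
        exact lintegral_signalForm_signs_le hp (X ω) hlam
    _ = _ := by
        rw [lintegral_const, measure_univ, mul_one, ← ENNReal.ofReal_mul (by positivity)]
        congr 1
        rw [show c ^ 8 = (c ^ 2) ^ 4 by ring, hc2]
        field_simp

end SignalMoment

/-! ### Traces of the resolvent in terms of `v_D` -/

section SVD

variable {n p : ℕ} {X D : Matrix (Fin n) (Fin p) ℝ} {Q : Matrix (Fin n) (Fin n) ℝ}
  {O : Matrix (Fin p) (Fin p) ℝ} {lam : ℝ}

theorem IsSVD.mul_transpose_eq_diagonal (h : IsSVD X Q D O) :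
    D * Dᵀ = Matrix.diagonal (D * Dᵀ).diag := by
  ext i j
  by_cases hij : i = j
  · subst hij; simp
  · rw [Matrix.diagonal_apply_ne _ hij, Matrix.mul_apply]
    refine Finset.sum_eq_zero fun k _ => ?_
    rw [Matrix.transpose_apply]
    by_cases hik : (i : ℕ) = k
    · rw [h.diagonal j k (fun hjk => hij (Fin.ext (hik.trans hjk.symm))), mul_zero]
    · rw [h.diagonal i k hik, zero_mul]

theorem diag_mul_transpose_nonneg (D : Matrix (Fin n) (Fin p) ℝ) (i : Fin n) :
    0 ≤ (D * Dᵀ).diag i := by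
  rw [Matrix.diag_apply, Matrix.mul_apply]
  exact Finset.sum_nonneg fun k _ => mul_self_nonneg _

theorem IsSVD.diag_le (h : IsSVD X Q D O) {C : ℝ} (hC : ∀ i j, D i j ≤ C) (i : Fin n) :
    (D * Dᵀ).diag i ≤ C ^ 2 := by
  rw [Matrix.diag_apply, Matrix.mul_apply]
  simp only [Matrix.transpose_apply]
  -- A row of `D` has at most one nonzero entry, and none when its index is at least `p`.
  by_cases hi : (i : ℕ) < p
  · rw [Finset.sum_eq_single (⟨i, hi⟩ : Fin p)]
    · have h0 := h.nonneg i ⟨i, hi⟩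
      have h1 := hC i ⟨i, hi⟩
      nlinarith
    · intro k _ hk
      rw [h.diagonal i k fun hik => hk (Fin.ext hik.symm), zero_mul]
    · simp
  · rw [Finset.sum_eq_zero fun k _ => ?_]
    · positivity
    · rw [h.diagonal i k fun hik => hi (hik ▸ k.2), zero_mul]

theorem IsSVD.resolvent_eq (h : IsSVD X Q D O) (hlam : 0 < lam) :
    resolvent X lam
      = Qᵀ * Matrix.diagonal (fun i => 1 / ((D * Dᵀ).diag i + lam)) * Q := by
  have hQ : Q * Qᵀ = 1 := (Matrix.mem_orthogonalGroup_iff _ _).1 h.left_orthogonal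
  have hQ' : Qᵀ * Q = 1 := (Matrix.mem_orthogonalGroup_iff' _ _).1 h.left_orthogonal
  have hO : O * Oᵀ = 1 := (Matrix.mem_orthogonalGroup_iff _ _).1 h.right_orthogonal
  refine Matrix.inv_eq_right_inv ?_
  have hX : X * Xᵀ + lam • (1 : Matrix (Fin n) (Fin n) ℝ)
      = Qᵀ * Matrix.diagonal (fun i => (D * Dᵀ).diag i + lam) * Q := by
    have h1 : X * Xᵀ = Qᵀ * (D * Dᵀ) * Q := by
      rw [h.eq]
      simp only [Matrix.transpose_mul, Matrix.transpose_transpose, Matrix.mul_assoc]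
      rw [← Matrix.mul_assoc O, hO, Matrix.one_mul]
    have h2 : Matrix.diagonal (fun i => (D * Dᵀ).diag i + lam)
        = D * Dᵀ + lam • (1 : Matrix (Fin n) (Fin n) ℝ) := by
      rw [h.mul_transpose_eq_diagonal, Matrix.smul_one_eq_diagonal, Matrix.diagonal_add]
      simp
    rw [h1, h2, Matrix.mul_add, Matrix.add_mul, Matrix.mul_smul, Matrix.mul_one, Matrix.smul_mul,
      hQ']
  have h3 : Matrix.diagonal (fun i => (D * Dᵀ).diag i + lam)
      * Matrix.diagonal (fun i => 1 / ((D * Dᵀ).diag i + lam)) = 1 := by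
    rw [Matrix.diagonal_mul_diagonal, ← Matrix.diagonal_one]
    congr 1
    ext i
    have := diag_mul_transpose_nonneg D i
    exact mul_one_div_cancel (by linarith)
  rw [hX]
  calc _ = Qᵀ * (Matrix.diagonal (fun i => (D * Dᵀ).diag i + lam) * (Q * Qᵀ)
        * Matrix.diagonal (fun i => 1 / ((D * Dᵀ).diag i + lam))) * Q := by
          simp only [Matrix.mul_assoc]
    _ = 1 := by rw [hQ, Matrix.mul_one, h3, Matrix.mul_one, hQ']

theorem IsSVD.trace_resolvent (h : IsSVD X Q D O) (hlam : 0 < lam) :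
    (resolvent X lam).trace = ∑ i, 1 / ((D * Dᵀ).diag i + lam) := by
  have hQ : Q * Qᵀ = 1 := (Matrix.mem_orthogonalGroup_iff _ _).1 h.left_orthogonal
  rw [h.resolvent_eq hlam, Matrix.trace_mul_comm, ← Matrix.mul_assoc, hQ, Matrix.one_mul,
    Matrix.trace_diagonal]

theorem IsSVD.trace_resolvent_sq (h : IsSVD X Q D O) (hlam : 0 < lam) :
    (resolvent X lam * resolvent X lam).trace = ∑ i, 1 / ((D * Dᵀ).diag i + lam) ^ 2 := by
  have hQ : Q * Qᵀ = 1 := (Matrix.mem_orthogonalGroup_iff _ _).1 h.left_orthogonal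
  set E := Matrix.diagonal (fun i => 1 / ((D * Dᵀ).diag i + lam)) with hE
  have : resolvent X lam * resolvent X lam = Qᵀ * (E * E) * Q := by
    rw [h.resolvent_eq hlam]
    calc _ = Qᵀ * (E * (Q * Qᵀ) * E) * Q := by simp only [Matrix.mul_assoc, hE]
      _ = _ := by rw [hQ, Matrix.mul_one]
  rw [this, Matrix.trace_mul_comm, ← Matrix.mul_assoc, hQ, Matrix.one_mul, hE,
    Matrix.diagonal_mul_diagonal, Matrix.trace_diagonal]
  refine Finset.sum_congr rfl fun i _ => ?_
  rw [div_mul_div_comm, one_mul, pow_two]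

theorem stieltjes_empiricalMeasure (a : Fin n → ℝ) (z : ℝ) :
    stieltjes (empiricalMeasure a) z = (1 / (n : ℝ)) * ∑ i, 1 / (a i - z) := by
  rw [stieltjes, empiricalMeasure, integral_smul_measure,
    integral_finsetSum_measure fun i _ => integrable_dirac (by simp)]
  simp

theorem vD_neg (D : Matrix (Fin n) (Fin p) ℝ) (lam : ℝ) :
    vD D (-lam) = (1 / (n : ℝ)) * ∑ i, 1 / ((D * Dᵀ).diag i + lam) := by
  simp [vD, stieltjes_empiricalMeasure]

theorem deriv_vD_neg (D : Matrix (Fin n) (Fin p) ℝ) (hlam : 0 < lam) :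
    deriv (vD D) (-lam) = (1 / (n : ℝ)) * ∑ i, 1 / ((D * Dᵀ).diag i + lam) ^ 2 := by
  have hfun : vD D = fun z => (1 / (n : ℝ)) * ∑ i, 1 / ((D * Dᵀ).diag i - z) :=
    funext fun z => stieltjes_empiricalMeasure _ z
  rw [hfun]
  refine HasDerivAt.deriv (HasDerivAt.const_mul _ (HasDerivAt.fun_sum fun i _ => ?_))
  have hi := diag_mul_transpose_nonneg D i
  have h1 : HasDerivAt (fun z : ℝ => (D * Dᵀ).diag i - z) (-1) (-lam) := by
    simpa using (hasDerivAt_id (-lam)).const_sub ((D * Dᵀ).diag i)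
  have h2 := h1.inv (by linarith)
  rw [sub_neg_eq_add, neg_neg] at h2
  simp only [one_div] at h2 ⊢
  exact h2

end SVD

/-! ### Exact decomposition of the GCV error -/

section Decomposition

variable {n p : ℕ} (X : Matrix (Fin n) (Fin p) ℝ) (lam : ℝ)

/-- The off-diagonal part of the noise quadratic form. -/
def noiseOffDiag (e : Fin n → ℝ) : ℝ :=
  ∑ i, ∑ j ∈ Finset.univ.erase i, (resolvent X lam * resolvent X lam) i j * e i * e j

/-- The centred diagonal part of the noise quadratic form. -/
def noiseDiag (σ : ℝ) (e : Fin n → ℝ) : ℝ :=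
  ∑ i, (resolvent X lam * resolvent X lam) i i * (e i ^ 2 - σ ^ 2)

/-- The coefficients of the cross term between signal and noise. -/
def crossVec (b : Fin p → ℝ) : Fin n → ℝ :=
  resolvent X lam *ᵥ (resolvent X lam *ᵥ (X *ᵥ b))

variable {X lam}

/-- Each quadratic form is written as centring plus fluctuation; the centrings `σ² tr G²` and `(tr B
/ p) ‖b‖²` are what survives in the limit. -/
theorem residual_sq_eq (b : Fin p → ℝ) (e : Fin n → ℝ) (σ : ℝ) :
    (resolvent X lam *ᵥ (X *ᵥ b + e)) ⬝ᵥ (resolvent X lam *ᵥ (X *ᵥ b + e))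
      = noiseOffDiag X lam e + noiseDiag X lam σ e
        + σ ^ 2 * (resolvent X lam * resolvent X lam).trace
        + 2 * (crossVec X lam b ⬝ᵥ e)
        + signalForm X lam b + (signalMatrix X lam).trace / p * (b ⬝ᵥ b) := by
  set G := resolvent X lam with hG
  have hself : ∀ u w : Fin n → ℝ, (G *ᵥ u) ⬝ᵥ (G *ᵥ w) = (G *ᵥ (G *ᵥ u)) ⬝ᵥ w := by
    intro u w
    rw [Matrix.dotProduct_mulVec, ← Matrix.mulVec_transpose, hG, resolvent_transpose]
  have h1 : (G *ᵥ (X *ᵥ b)) ⬝ᵥ (G *ᵥ (X *ᵥ b)) = b ⬝ᵥ (signalMatrix X lam *ᵥ b) := by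
    rw [hself, signalMatrix, ← hG, ← Matrix.mulVec_mulVec, ← Matrix.mulVec_mulVec,
      ← Matrix.mulVec_mulVec, Matrix.dotProduct_mulVec, ← Matrix.mulVec_transpose,
      dotProduct_comm]
  have h2 : (G *ᵥ e) ⬝ᵥ (G *ᵥ e) = noiseOffDiag X lam e + noiseDiag X lam σ e
      + σ ^ 2 * (G * G).trace := by
    rw [hself, dotProduct_comm, Matrix.mulVec_mulVec, dotProduct_mulVec_eq_offDiag_add,
      noiseOffDiag, noiseDiag, Matrix.trace, Finset.mul_sum, ← Finset.sum_add_distrib,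
      ← Finset.sum_add_distrib, ← Finset.sum_add_distrib]
    refine Finset.sum_congr rfl fun i _ => ?_
    rw [← hG, Matrix.diag_apply]; ring
  have h3 : (G *ᵥ (X *ᵥ b)) ⬝ᵥ (G *ᵥ e) = crossVec X lam b ⬝ᵥ e := by
    rw [hself, crossVec]
  rw [Matrix.mulVec_add, add_dotProduct, dotProduct_add, dotProduct_add, h1, h2,
    dotProduct_comm (G *ᵥ e) (G *ᵥ (X *ᵥ b)), h3, signalForm]
  ring

/-- Both quantities have denominator `v_D²` after dividing out `γ`, and the `σ²` terms cancel
exactly. Besides the fluctuations only the difference between `n / p` and `1 / γ` in the signal term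
remains. -/
theorem IsSVD.gcv_sub_gcvEquivalent {D : Matrix (Fin n) (Fin p) ℝ}
    {Q : Matrix (Fin n) (Fin n) ℝ} {O : Matrix (Fin p) (Fin p) ℝ} (h : IsSVD X Q D O)
    (hlam : 0 < lam) (hn : n ≠ 0) (hp : p ≠ 0) {γ r σ : ℝ} (hγ : γ ≠ 0) (b : Fin p → ℝ)
    (hb : b ⬝ᵥ b = r ^ 2 * n) (e : Fin n → ℝ) :
    gcv X (X *ᵥ b + e) lam - gcvEquivalent γ r σ D lam
      = ((1 / n) * noiseOffDiag X lam e + (1 / n) * noiseDiag X lam σ e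
        + 2 * ((1 / n) * (crossVec X lam b ⬝ᵥ e)) + (1 / n) * signalForm X lam b
        + r ^ 2 * (vD D (-lam) - lam * deriv (vD D) (-lam)) * ((p / n : ℝ)⁻¹ - γ⁻¹))
          / vD D (-lam) ^ 2 := by
  have hn' : (n : ℝ) ≠ 0 := by exact_mod_cast hn
  have hp' : (p : ℝ) ≠ 0 := by exact_mod_cast hp
  have hv : (resolvent X lam).trace = n * vD D (-lam) := by
    rw [h.trace_resolvent hlam, vD_neg]; field_simp
  have hv' : (resolvent X lam * resolvent X lam).trace = n * deriv (vD D) (-lam) := by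
    rw [h.trace_resolvent_sq hlam, deriv_vD_neg D hlam]; field_simp
  rw [gcv_eq X hn hlam, residual_sq_eq b e σ, trace_signalMatrix X hlam, hb, hv, hv',
    mul_div_cancel_left₀ _ hn', gcvEquivalent, ← div_div, ← sub_div]
  congr 1
  field_simp
  ring

theorem crossVec_sq_le (hlam : 0 < lam) (b : Fin p → ℝ) :
    crossVec X lam b ⬝ᵥ crossVec X lam b ≤ (b ⬝ᵥ b) / lam / lam ^ 2 :=
  (resolvent_mulVec_sq_le X hlam _).trans
    (div_le_div_of_nonneg_right (resolvent_mul_mulVec_sq_le X hlam b) (by positivity))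

end Decomposition

/-! ### Bounds on `v_D` uniform in `n` -/

section Bounds

variable {n p : ℕ} (D : Matrix (Fin n) (Fin p) ℝ) {lam : ℝ}

/-- The difference is the average of `d / (d + lam)²`, and `d * lam ≤ (d + lam)²`. No bound on the
singular values is needed. -/
theorem abs_vD_sub_le (hlam : 0 < lam) :
    |vD D (-lam) - lam * deriv (vD D) (-lam)| ≤ 1 / lam := by
  rw [vD_neg, deriv_vD_neg D hlam]
  have h1 : (1 / (n : ℝ)) * ∑ i, 1 / ((D * Dᵀ).diag i + lam)
      - lam * ((1 / (n : ℝ)) * ∑ i, 1 / ((D * Dᵀ).diag i + lam) ^ 2)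
      = (1 / (n : ℝ)) * ∑ i, (D * Dᵀ).diag i / ((D * Dᵀ).diag i + lam) ^ 2 := by
    rw [mul_left_comm, ← mul_sub, Finset.mul_sum, ← Finset.sum_sub_distrib]
    congr 1
    refine Finset.sum_congr rfl fun i _ => ?_
    have := diag_mul_transpose_nonneg D i
    have h0 : (D * Dᵀ).diag i + lam ≠ 0 := by linarith
    field_simp
    ring
  have h2 : ∀ i, 0 ≤ (D * Dᵀ).diag i / ((D * Dᵀ).diag i + lam) ^ 2 := fun i => by
    have := diag_mul_transpose_nonneg D i
    positivity
  have h3 : ∀ i, (D * Dᵀ).diag i / ((D * Dᵀ).diag i + lam) ^ 2 ≤ 1 / lam := fun i => by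
    have := diag_mul_transpose_nonneg D i
    rw [div_le_div_iff₀ (by positivity) hlam]
    nlinarith
  rw [h1, abs_of_nonneg (mul_nonneg (by positivity) (Finset.sum_nonneg fun i _ => h2 i))]
  rcases Nat.eq_zero_or_pos n with hn | hn
  · subst hn; simp; positivity
  · have hn' : (0 : ℝ) < n := by exact_mod_cast hn
    have := Finset.sum_le_sum fun i (_ : i ∈ Finset.univ) => h3 i
    rw [one_div, inv_mul_le_iff₀ hn']
    simpa using this

/-- This keeps the denominator of GCV away from zero, and is the only place where the bound on the
singular values enters. -/
theorem le_vD {K : ℝ} (hn : n ≠ 0) (hlam : 0 < lam) (hK : ∀ i, (D * Dᵀ).diag i ≤ K) :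
    1 / (K + lam) ≤ vD D (-lam) := by
  have hn' : (0 : ℝ) < n := by exact_mod_cast Nat.pos_of_ne_zero hn
  rw [vD_neg, one_div (n : ℝ), le_inv_mul_iff₀ hn']
  have h : ∀ i, 1 / (K + lam) ≤ 1 / ((D * Dᵀ).diag i + lam) := fun i => by
    have := diag_mul_transpose_nonneg D i
    have := hK i
    exact one_div_le_one_div_of_le (by linarith) (by linarith)
  have := Finset.sum_le_sum fun i (_ : i ∈ Finset.univ) => h i
  simpa using this

end Bounds

section Continuity

variable {n p : ℕ} {lam : ℝ}

theorem continuous_noiseOffDiag (hlam : 0 < lam) :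
    Continuous fun z : (Fin n → ℝ) × (Matrix (Fin n) (Fin p) ℝ × (Fin p → ℝ)) =>
      noiseOffDiag z.2.1 lam z.1 := by
  have hR : Continuous fun X : Matrix (Fin n) (Fin p) ℝ => resolvent X lam * resolvent X lam :=
    (continuous_resolvent hlam).matrix_mul (continuous_resolvent hlam)
  refine continuous_finsetSum _ fun i _ => continuous_finsetSum _ fun j _ => ?_
  have := (hR.matrix_elem i j).comp (continuous_fst.comp continuous_snd :
    Continuous fun z : (Fin n → ℝ) × (Matrix (Fin n) (Fin p) ℝ × (Fin p → ℝ)) => z.2.1)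
  exact (this.mul (by fun_prop)).mul (by fun_prop)

theorem continuous_noiseDiag (hlam : 0 < lam) (σ : ℝ) :
    Continuous fun z : (Fin n → ℝ) × (Matrix (Fin n) (Fin p) ℝ × (Fin p → ℝ)) =>
      noiseDiag z.2.1 lam σ z.1 := by
  have hR : Continuous fun X : Matrix (Fin n) (Fin p) ℝ => resolvent X lam * resolvent X lam :=
    (continuous_resolvent hlam).matrix_mul (continuous_resolvent hlam)
  refine continuous_finsetSum _ fun i _ => ?_
  have := (hR.matrix_elem i i).comp (continuous_fst.comp continuous_snd :
    Continuous fun z : (Fin n → ℝ) × (Matrix (Fin n) (Fin p) ℝ × (Fin p → ℝ)) => z.2.1)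
  exact this.mul (by fun_prop)

theorem continuous_crossVec (hlam : 0 < lam) :
    Continuous fun z : Matrix (Fin n) (Fin p) ℝ × (Fin p → ℝ) => crossVec z.1 lam z.2 := by
  have hR : Continuous fun z : Matrix (Fin n) (Fin p) ℝ × (Fin p → ℝ) => resolvent z.1 lam :=
    (continuous_resolvent hlam).comp continuous_fst
  exact hR.matrix_mulVec (hR.matrix_mulVec (continuous_fst.matrix_mulVec continuous_snd))

end Continuity

/-! ### Convergence of each error term -/

section Terms

variable {Ω : Type*} [MeasurableSpace Ω] {P : Measure Ω} [IsProbabilityMeasure P]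

theorem ae_tendsto_zero_of_indepFun {α β : ℕ → Type*} [∀ n, MeasurableSpace (α n)]
    [∀ n, MeasurableSpace (β n)] {U : ∀ n, Ω → α n} {V : ∀ n, Ω → β n}
    (hU : ∀ n, Measurable (U n)) (hV : ∀ n, Measurable (V n))
    (hind : ∀ n, IndepFun (U n) (V n) P) {F : ∀ n, α n → β n → ℝ}
    (hF : ∀ n, Measurable fun z : α n × β n => F n z.1 z.2) {q s C : ℝ} (hq : 0 < q) (hs : 1 < s)
    (h : ∀ᶠ n : ℕ in atTop, ∀ᵐ ω ∂P, ∫⁻ ω', ENNReal.ofReal (|F n (U n ω') (V n ω)| ^ q) ∂P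
      ≤ ENNReal.ofReal (C * (n : ℝ) ^ (-s))) :
    ∀ᵐ ω ∂P, Tendsto (fun n => F n (U n ω) (V n ω)) atTop (𝓝 0) := by
  refine ae_tendsto_zero_of_moment_le (fun n => (hF n).comp ((hU n).prodMk (hV n))) hq hs
    (C := C) ?_
  filter_upwards [h] with n hn
  exact lintegral_le_of_indepFun (F := fun z => ENNReal.ofReal (|F n z.1 z.2| ^ q)) (hU n) (hV n)
    (hind n) ((hF n).abs.pow_const q).ennreal_ofReal hn

theorem abs_inv_mul_rpow_four (n : ℕ) (x : ℝ) :
    |(1 / (n : ℝ)) * x| ^ (4 : ℝ) = (1 / (n : ℝ)) ^ 4 * x ^ 4 := by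
  rw [show (4 : ℝ) = ((4 : ℕ) : ℝ) by norm_num, Real.rpow_natCast, abs_mul, mul_pow,
    Even.pow_abs ⟨2, rfl⟩, Even.pow_abs ⟨2, rfl⟩]

/-- The columns of `G²` are bounded uniformly in the design, so the normalised fourth moment is of
order `n⁻⁴ * n² = n⁻²`. -/
theorem ae_tendsto_noiseOffDiag {p : ℕ → ℕ} {X : (n : ℕ) → Ω → Matrix (Fin n) (Fin (p n)) ℝ}
    {β : (n : ℕ) → Ω → Fin (p n) → ℝ} {ε : (n : ℕ) → Ω → Fin n → ℝ}
    (hX : ∀ n, Measurable (X n)) (hβ : ∀ n, Measurable (β n)) (hε : ∀ n, Measurable (ε n))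
    (hind : ∀ n, IndepFun (ε n) (fun ω => (X n ω, β n ω)) P) {κ : ℝ}
    (hc : ∀ n, CenteredFamily P (fun (i : Fin n) ω => ε n ω i) κ) {lam : ℝ} (hlam : 0 < lam) :
    ∀ᵐ ω ∂P, Tendsto (fun n : ℕ => (1 / (n : ℝ)) * noiseOffDiag (X n ω) lam (ε n ω)) atTop
      (𝓝 0) := by
  set τ := (1 / lam ^ 2) ^ 2 with hτ
  refine ae_tendsto_zero_of_indepFun (q := 4) (s := 2) (C := 1216 * κ ^ 4 * τ ^ 2) hε
    (fun n => (hX n).prodMk (hβ n)) hind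
    (F := fun n e z => (1 / (n : ℝ)) * noiseOffDiag z.1 lam e)
    (fun n => ((continuous_noiseOffDiag hlam).measurable.const_mul _)) (by norm_num)
    (by norm_num) ?_
  filter_upwards [eventually_ne_atTop 0] with n hn
  refine ae_of_all _ fun ω => ?_
  have hn' : (n : ℝ) ≠ 0 := by exact_mod_cast hn
  simp only [abs_inv_mul_rpow_four]
  set A := resolvent (X n ω) lam * resolvent (X n ω) lam with hA
  have hsymm : ∀ i j, A i j = A j i := fun i j => by
    have : Aᵀ = A := by rw [hA, Matrix.transpose_mul, resolvent_transpose]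
    conv_lhs => rw [← this]
    rfl
  have h := (hc n).quadratic (fun i j => A i j) hsymm Finset.univ (τ := τ)
    fun k t _ => (Finset.sum_le_univ_sum_of_nonneg
      fun i => sq_nonneg _).trans (sum_sq_col_resolvent_sq (X n ω) hlam k)
  refine lintegral_ofReal_le (h.1.const_mul _) (fun ω => by positivity) ?_
  rw [integral_const_mul]
  refine (mul_le_mul_of_nonneg_left h.2 (by positivity)).trans (le_of_eq ?_)
  rw [Real.rpow_neg (Nat.cast_nonneg _), Real.rpow_two]
  simp only [Finset.card_univ, Fintype.card_fin]
  field_simp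

/-- The coefficient map `u` is left general because two cross terms need it: the one in GCV and the
one in the risk of the orthogonal model. -/
theorem ae_tendsto_linear {p : ℕ → ℕ} {X : (n : ℕ) → Ω → Matrix (Fin n) (Fin (p n)) ℝ}
    {β : (n : ℕ) → Ω → Fin (p n) → ℝ} {ε : (n : ℕ) → Ω → Fin n → ℝ}
    (hX : ∀ n, Measurable (X n)) (hβ : ∀ n, Measurable (β n)) (hε : ∀ n, Measurable (ε n))
    (hind : ∀ n, IndepFun (ε n) (fun ω => (X n ω, β n ω)) P) {κ : ℝ}
    (hc : ∀ n, CenteredFamily P (fun (i : Fin n) ω => ε n ω i) κ)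
    {u : ∀ n, Matrix (Fin n) (Fin (p n)) ℝ × (Fin (p n) → ℝ) → Fin n → ℝ}
    (hu : ∀ n, Measurable (u n)) {K : ℝ}
    (hK : ∀ n ≠ 0, ∀ᵐ ω ∂P, u n (X n ω, β n ω) ⬝ᵥ u n (X n ω, β n ω) ≤ K * n) :
    ∀ᵐ ω ∂P, Tendsto (fun n : ℕ => (1 / (n : ℝ)) * (u n (X n ω, β n ω) ⬝ᵥ ε n ω)) atTop
      (𝓝 0) := by
  refine ae_tendsto_zero_of_indepFun (q := 4) (s := 2) (C := 4 * κ ^ 2 * K ^ 2) hε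
    (fun n => (hX n).prodMk (hβ n)) hind
    (F := fun n e z => (1 / (n : ℝ)) * (u n z ⬝ᵥ e))
    (fun n => Measurable.const_mul ?_ _) (by norm_num) (by norm_num) ?_
  · refine Finset.measurable_sum _ fun i _ => Measurable.mul ?_ ?_
    · exact (measurable_pi_apply i).comp ((hu n).comp measurable_snd)
    · exact (measurable_pi_apply i).comp measurable_fst
  filter_upwards [eventually_ne_atTop 0] with n hn
  filter_upwards [hK n hn] with ω hω
  have hn' : (n : ℝ) ≠ 0 := by exact_mod_cast hn
  simp only [abs_inv_mul_rpow_four]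
  set w := u n (X n ω, β n ω) with hw
  have h := (hc n).linear w Finset.univ
  refine lintegral_ofReal_le (h.1.const_mul _) (fun ω => by positivity) ?_
  rw [integral_const_mul]
  have hw2 : ∑ i, w i ^ 2 = w ⬝ᵥ w := by simp [dotProduct, pow_two]
  have hwn := dotProduct_self_nonneg' w
  rw [hw2] at h
  have h3 : ∫ ω, (w ⬝ᵥ ε n ω) ^ 4 ∂P ≤ 4 * κ ^ 2 * (K * n) ^ 2 :=
    h.2.2.trans (by gcongr)
  refine (mul_le_mul_of_nonneg_left h3 (by positivity)).trans (le_of_eq ?_)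
  rw [Real.rpow_neg (Nat.cast_nonneg _), Real.rpow_two]
  field_simp

/-- Variances alone would give the non-summable rate `1 / n`; a moment of order `2 + δ` gives `n ^
(-(1 + δ / 2))`. The entries of `G²` are bounded by `1 / lam²`. -/
theorem ae_tendsto_noiseDiag {p : ℕ → ℕ} {X : (n : ℕ) → Ω → Matrix (Fin n) (Fin (p n)) ℝ}
    {β : (n : ℕ) → Ω → Fin (p n) → ℝ} {ε : (n : ℕ) → Ω → Fin n → ℝ}
    (hX : ∀ n, Measurable (X n)) (hβ : ∀ n, Measurable (β n)) (hε : ∀ n, Measurable (ε n))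
    (hind : ∀ n, IndepFun (ε n) (fun ω => (X n ω, β n ω)) P)
    (hent : ∀ n, iIndepFun (fun (i : Fin n) ω => ε n ω i) P) {σ δ v M : ℝ} (hδ : 0 < δ)
    (hδ1 : δ ≤ 1) (hv : 0 ≤ v) (hM : 0 ≤ M)
    (hi : ∀ n i, Integrable (fun ω => |ε n ω i ^ 2 - σ ^ 2| ^ (2 + δ)) P)
    (h0 : ∀ n i, ∫ ω, (ε n ω i ^ 2 - σ ^ 2) ∂P = 0)
    (h2 : ∀ n i, ∫ ω, (ε n ω i ^ 2 - σ ^ 2) ^ 2 ∂P ≤ v)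
    (hq : ∀ n i, ∫ ω, |ε n ω i ^ 2 - σ ^ 2| ^ (2 + δ) ∂P ≤ M) {lam : ℝ} (hlam : 0 < lam) :
    ∀ᵐ ω ∂P, Tendsto (fun n : ℕ => (1 / (n : ℝ)) * noiseDiag (X n ω) lam σ (ε n ω)) atTop
      (𝓝 0) := by
  set c := 1 / lam ^ 2 with hc
  have hc0 : 0 ≤ c := by positivity
  set v' := c ^ 2 * v with hv'
  set M' := c ^ (2 + δ) * M with hM'
  refine ae_tendsto_zero_of_indepFun (q := 2 + δ) (s := 1 + δ / 2)
    (C := (2 + δ) * (2 * (1 + v') * v' + M')) hε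
    (fun n => (hX n).prodMk (hβ n)) hind
    (F := fun n e z => (1 / (n : ℝ)) * noiseDiag z.1 lam σ e)
    (fun n => ((continuous_noiseDiag hlam σ).measurable.const_mul _)) (by linarith)
    (by linarith) ?_
  filter_upwards [eventually_ne_atTop 0] with n hn
  refine ae_of_all _ fun ω => ?_
  have hn' : (0 : ℝ) < n := by exact_mod_cast Nat.pos_of_ne_zero hn
  set A := resolvent (X n ω) lam * resolvent (X n ω) lam with hA
  have hAc : ∀ i, |A i i| ≤ c := fun i => by
    refine abs_le_of_sq_le_sq ?_ hc0
    exact (Finset.single_le_sum (f := fun j => A j i ^ 2) (fun j _ => sq_nonneg _)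
      (Finset.mem_univ i)).trans (sum_sq_col_resolvent_sq (X n ω) hlam i)
  have hεi : ∀ i, Measurable fun ω => ε n ω i := fun i => (measurable_pi_apply i).comp (hε n)
  have hpow : ∀ (i : Fin n) (ω : Ω), |A i i * (ε n ω i ^ 2 - σ ^ 2)| ^ (2 + δ)
      = |A i i| ^ (2 + δ) * |ε n ω i ^ 2 - σ ^ 2| ^ (2 + δ) := fun i ω => by
    rw [abs_mul, Real.mul_rpow (abs_nonneg _) (abs_nonneg _)]
  have h := sum_abs_moment_le (P := P) (e := fun (i : Fin n) ω => A i i * (ε n ω i ^ 2 - σ ^ 2))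
    (v := v') (M := M') (N := n) hδ hδ1 (fun i => by have := hεi i; fun_prop)
    ((hent n).comp (fun i x => A i i * (x ^ 2 - σ ^ 2)) (fun i => by fun_prop))
    (fun i => by
      simp only [hpow]
      exact (hi n i).const_mul _)
    (fun i => by rw [integral_const_mul, h0, mul_zero])
    (fun i => by
      simp only [mul_pow]
      rw [integral_const_mul]
      have h1 : A i i ^ 2 ≤ c ^ 2 := by
        rw [← sq_abs]; exact pow_le_pow_left₀ (abs_nonneg _) (hAc i) 2
      exact mul_le_mul h1 (h2 n i) (integral_nonneg fun ω => by positivity) (by positivity))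
    (fun i => by
      simp only [hpow]
      rw [integral_const_mul]
      have h1 : |A i i| ^ (2 + δ) ≤ c ^ (2 + δ) :=
        Real.rpow_le_rpow (abs_nonneg _) (hAc i) (by linarith)
      exact mul_le_mul h1 (hq n i) (integral_nonneg fun ω => by positivity) (by positivity))
    (by positivity) (by positivity) (by exact_mod_cast Nat.pos_of_ne_zero hn) Finset.univ
    (by simp)
  have hscale : ∀ ω', |(1 / (n : ℝ)) * noiseDiag (X n ω) lam σ (ε n ω')| ^ (2 + δ)
      = (n : ℝ) ^ (-(2 + δ)) * |∑ i, A i i * (ε n ω' i ^ 2 - σ ^ 2)| ^ (2 + δ) := fun ω' => by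
    rw [abs_mul, Real.mul_rpow (abs_nonneg _) (abs_nonneg _), abs_of_nonneg (by positivity),
      one_div, Real.inv_rpow hn'.le, ← Real.rpow_neg hn'.le]
    rfl
  simp only [hscale]
  refine lintegral_ofReal_le (h.1.const_mul _) (fun ω => by positivity) ?_
  rw [integral_const_mul]
  refine (mul_le_mul_of_nonneg_left h.2.2 (by positivity)).trans (le_of_eq ?_)
  simp only [Finset.card_univ, Fintype.card_fin]
  have e1 : (n : ℝ) ^ (-(1 + δ / 2)) = (n : ℝ) ^ (-(2 + δ)) * ((n : ℝ) * (n : ℝ) ^ (δ / 2)) := by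
    rw [← Real.rpow_one_add' hn'.le (by linarith), ← Real.rpow_add hn']
    congr 1; ring
  rw [e1]; ring

/-- Here `β` is frozen and `X` is integrated. The normalised fourth moment is of order `r⁸ / p²`,
and eventually `p > γ n / 2`. -/
theorem ae_tendsto_signalForm {p : ℕ → ℕ} {X : (n : ℕ) → Ω → Matrix (Fin n) (Fin (p n)) ℝ}
    {β : (n : ℕ) → Ω → Fin (p n) → ℝ}
    (hX : ∀ n, Measurable (X n)) (hβ : ∀ n, Measurable (β n))
    (hind : ∀ n, IndepFun (β n) (X n) P) (hinv : ∀ n, RightRotationallyInvariant P (X n))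
    {γ r : ℝ} (hγ : 0 < γ)
    (hp : Tendsto (fun n : ℕ => (p n : ℝ) / (n : ℝ)) atTop (𝓝 γ))
    (hr : ∀ n ≠ 0, ∀ᵐ ω ∂P, β n ω ⬝ᵥ β n ω = r ^ 2 * n) {lam : ℝ} (hlam : 0 < lam) :
    ∀ᵐ ω ∂P, Tendsto (fun n : ℕ => (1 / (n : ℝ)) * signalForm (X n ω) lam (β n ω)) atTop
      (𝓝 0) := by
  refine ae_tendsto_zero_of_indepFun (q := 4) (s := 2)
    (C := 1216 * (1 / lam) ^ 4 * r ^ 8 * (4 / γ ^ 2)) hX hβ (fun n => (hind n).symm)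
    (F := fun n Y b => (1 / (n : ℝ)) * signalForm Y lam b)
    (fun n => (continuous_signalForm hlam).measurable.const_mul _) (by norm_num) (by norm_num) ?_
  filter_upwards [eventually_ne_atTop 0, hp.eventually_const_lt (half_lt_self hγ)] with n hn hpn
  filter_upwards [hr n hn] with ω hω
  have hn' : (0 : ℝ) < n := by exact_mod_cast Nat.pos_of_ne_zero hn
  rw [lt_div_iff₀ hn'] at hpn
  have hp0 : (0 : ℝ) < p n := lt_trans (by positivity) hpn
  have hpne : p n ≠ 0 := by
    intro h0
    rw [h0] at hp0
    simp at hp0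
  simp only [abs_inv_mul_rpow_four]
  have h := lintegral_signalForm_le hpne (hX n) (hinv n) hlam (β n ω)
  have hm : Measurable fun ω' => ENNReal.ofReal (signalForm (X n ω') lam (β n ω) ^ 4) :=
    (((continuous_signalForm hlam).measurable.comp
      ((hX n).prodMk measurable_const)).pow_const 4).ennreal_ofReal
  have e1 : ∀ ω', ENNReal.ofReal ((1 / (n : ℝ)) ^ 4 * signalForm (X n ω') lam (β n ω) ^ 4)
      = ENNReal.ofReal ((1 / (n : ℝ)) ^ 4)
        * ENNReal.ofReal (signalForm (X n ω') lam (β n ω) ^ 4) := fun ω' =>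
    ENNReal.ofReal_mul (by positivity)
  simp only [e1]
  rw [lintegral_const_mul _ hm]
  refine (mul_le_mul_right h _).trans ?_
  rw [← ENNReal.ofReal_mul (by positivity)]
  refine ENNReal.ofReal_le_ofReal ?_
  rw [hω, Real.rpow_neg (Nat.cast_nonneg _), Real.rpow_two]
  have h4 : 1 / (p n : ℝ) ^ 2 ≤ 4 / γ ^ 2 / n ^ 2 := by
    rw [div_div, div_le_div_iff₀ (by positivity) (by positivity)]
    have := pow_le_pow_left₀ (by positivity : 0 ≤ γ / 2 * (n : ℝ)) hpn.le 2
    linarith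
  calc _ = 1216 * (1 / lam) ^ 4 * r ^ 8 * (1 / (p n : ℝ) ^ 2) := by field_simp
    _ ≤ 1216 * (1 / lam) ^ 4 * r ^ 8 * (4 / γ ^ 2 / n ^ 2) := by gcongr
    _ = _ := by field_simp

end Terms

theorem add_rpow_le_two_mul_rpow_add {a b q : ℝ} (ha : 0 ≤ a) (hb : 0 ≤ b) (hq : 0 ≤ q) :
    (a + b) ^ q ≤ (2 * a) ^ q + (2 * b) ^ q := by
  have h1 : 0 ≤ (2 * a) ^ q := by positivity
  have h2 : 0 ≤ (2 * b) ^ q := by positivity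
  rcases le_total a b with h | h
  · linarith [Real.rpow_le_rpow (by linarith) (by linarith : a + b ≤ 2 * b) hq]
  · linarith [Real.rpow_le_rpow (by linarith) (by linarith : a + b ≤ 2 * a) hq]

theorem norm_toLp_sq {m : ℕ} (b : Fin m → ℝ) : ‖WithLp.toLp 2 b‖ ^ 2 = b ⬝ᵥ b := by
  rw [EuclideanSpace.real_norm_sq_eq]
  simp [dotProduct, pow_two]

/-! ### Assembling the almost sure limit -/

section Model

variable {Ω : Type*} [MeasurableSpace Ω] {P : Measure Ω}
  {γ r σ : ℝ} {p : ℕ → ℕ}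
  {X : (n : ℕ) → Ω → Matrix (Fin n) (Fin (p n)) ℝ}
  {Q : (n : ℕ) → Ω → Matrix (Fin n) (Fin n) ℝ}
  {D : (n : ℕ) → Ω → Matrix (Fin n) (Fin (p n)) ℝ}
  {O : (n : ℕ) → Ω → Matrix (Fin (p n)) (Fin (p n)) ℝ}
  {β : (n : ℕ) → Ω → Fin (p n) → ℝ} {ε : (n : ℕ) → Ω → Fin n → ℝ}

theorem TrainingModel.centeredFamily [IsProbabilityMeasure P]
    (h : TrainingModel P γ r σ p X Q D O β ε) :
    ∃ κ, ∀ n, CenteredFamily P (fun (i : Fin n) ω => ε n ω i) κ := by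
  obtain ⟨η, hη, M, hM⟩ := h.noise_moment
  have hεm : ∀ n (i : Fin n), Measurable fun ω => ε n ω i := fun n i =>
    (measurable_pi_apply i).comp (h.measurable_noise n)
  have hpow : ∀ (k : ℕ), (k : ℝ) ≤ 4 → Even k → ∀ n (i : Fin n),
      Integrable (fun ω => ε n ω i ^ k) P ∧ ∫ ω, ε n ω i ^ k ∂P ≤ 1 + |M| := by
    intro k hk hke n i
    have hle : ∀ ω, ε n ω i ^ k ≤ 1 + |ε n ω i| ^ (4 + η) := fun ω => by
      rw [← hke.pow_abs, ← Real.rpow_natCast]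
      exact rpow_le_one_add_rpow (abs_nonneg _) (Nat.cast_nonneg _) (by linarith)
    have hint : Integrable (fun ω => 1 + |ε n ω i| ^ (4 + η)) P :=
      (integrable_const _).add (hM n i).1
    have hi : Integrable (fun ω => ε n ω i ^ k) P := by
      refine hint.mono' ((hεm n i).pow_const k).aestronglyMeasurable (ae_of_all _ fun ω => ?_)
      rw [Real.norm_eq_abs, abs_of_nonneg (hke.pow_nonneg _)]
      exact hle ω
    refine ⟨hi, (integral_mono hi hint hle).trans ?_⟩
    rw [integral_add (integrable_const _) (hM n i).1]
    simp only [integral_const, probReal_univ, smul_eq_mul, one_mul]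
    linarith [(hM n i).2, le_abs_self M]
  refine ⟨1 + |M|, fun n => ⟨hεm n, h.noise_entries_indep n, fun i => ?_, h.noise_mean n,
    fun i => ?_, fun i => ?_, by linarith [abs_nonneg M]⟩⟩
  · exact (hpow 4 (by norm_num) ⟨2, rfl⟩ n i).1
  · exact (hpow 2 (by norm_num) ⟨1, rfl⟩ n i).2
  · exact (hpow 4 (by norm_num) ⟨2, rfl⟩ n i).2

theorem TrainingModel.ae_tendsto_noiseDiag [IsProbabilityMeasure P]
    (h : TrainingModel P γ r σ p X Q D O β ε)
    {lam : ℝ} (hlam : 0 < lam) :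
    ∀ᵐ ω ∂P, Tendsto (fun n : ℕ => (1 / (n : ℝ)) * noiseDiag (X n ω) lam σ (ε n ω)) atTop
      (𝓝 0) := by
  obtain ⟨κ, hκ⟩ := h.centeredFamily
  obtain ⟨η, hη, M, hM⟩ := h.noise_moment
  have hεm : ∀ n (i : Fin n), Measurable fun ω => ε n ω i := fun n i =>
    (measurable_pi_apply i).comp (h.measurable_noise n)
  -- Chosen so that `2 (2 + δ) ≤ 4 + η`, which bounds the moment of `ε² - σ²`, and `δ ≤ 1`, as the
  -- moment inequality requires.
  set δ := min 1 (η / 2) with hδdef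
  have hδ : 0 < δ := lt_min one_pos (by linarith)
  have hδ1 : δ ≤ 1 := min_le_left _ _
  have hδη : δ ≤ η / 2 := min_le_right _ _
  set K := (2 : ℝ) ^ (2 + δ) * (1 + |M|) + (2 * σ ^ 2) ^ (2 + δ) with hK
  have hK0 : 0 ≤ K := by positivity
  have hle : ∀ n (i : Fin n) ω, |ε n ω i ^ 2 - σ ^ 2| ^ (2 + δ)
      ≤ (2 : ℝ) ^ (2 + δ) * (1 + |ε n ω i| ^ (4 + η)) + (2 * σ ^ 2) ^ (2 + δ) := by
    intro n i ω
    have h1 : |ε n ω i ^ 2 - σ ^ 2| ≤ ε n ω i ^ 2 + σ ^ 2 := by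
      rw [abs_le]; constructor <;> nlinarith [sq_nonneg (ε n ω i), sq_nonneg σ]
    have h2 : (2 * ε n ω i ^ 2) ^ (2 + δ) ≤ (2 : ℝ) ^ (2 + δ) * (1 + |ε n ω i| ^ (4 + η)) := by
      rw [Real.mul_rpow (by norm_num) (sq_nonneg _), ← sq_abs, ← Real.rpow_natCast |ε n ω i| 2,
        ← Real.rpow_mul (abs_nonneg _)]
      refine mul_le_mul_of_nonneg_left (rpow_le_one_add_rpow (abs_nonneg _) ?_ ?_) (by positivity)
      · push_cast; linarith
      · push_cast; linarith
    calc _ ≤ (ε n ω i ^ 2 + σ ^ 2) ^ (2 + δ) :=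
          Real.rpow_le_rpow (abs_nonneg _) h1 (by linarith)
      _ ≤ _ := (add_rpow_le_two_mul_rpow_add (sq_nonneg _) (sq_nonneg _) (by linarith)).trans
          (by linarith)
  have hint : ∀ n (i : Fin n), Integrable (fun ω =>
      (2 : ℝ) ^ (2 + δ) * (1 + |ε n ω i| ^ (4 + η)) + (2 * σ ^ 2) ^ (2 + δ)) P := fun n i =>
    (((integrable_const _).add (hM n i).1).const_mul _).add (integrable_const _)
  have hi : ∀ n (i : Fin n), Integrable (fun ω => |ε n ω i ^ 2 - σ ^ 2| ^ (2 + δ)) P := by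
    intro n i
    refine (hint n i).mono' ((((hεm n i).pow_const 2).sub_const _).abs.pow_const
      _).aestronglyMeasurable (ae_of_all _ fun ω => ?_)
    rw [Real.norm_eq_abs, abs_of_nonneg (by positivity)]
    exact hle n i ω
  have hq : ∀ n (i : Fin n), ∫ ω, |ε n ω i ^ 2 - σ ^ 2| ^ (2 + δ) ∂P ≤ K := by
    intro n i
    refine (integral_mono (hi n i) (hint n i) (hle n i)).trans ?_
    have i1 : Integrable (fun ω => 1 + |ε n ω i| ^ (4 + η)) P :=
      (integrable_const _).add (hM n i).1
    rw [integral_add (i1.const_mul _) (integrable_const _), integral_const_mul,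
      integral_add (integrable_const _) (hM n i).1]
    simp only [integral_const, probReal_univ, smul_eq_mul, one_mul]
    have := (hM n i).2.trans (le_abs_self M)
    rw [hK]
    gcongr
  have hsq : ∀ n (i : Fin n) ω, (ε n ω i ^ 2 - σ ^ 2) ^ 2
      ≤ 1 + |ε n ω i ^ 2 - σ ^ 2| ^ (2 + δ) := fun n i ω => by
    rw [← sq_abs, ← Real.rpow_natCast]
    exact rpow_le_one_add_rpow (abs_nonneg _) (Nat.cast_nonneg _) (by push_cast; linarith)
  have hint2 : ∀ n (i : Fin n), Integrable (fun ω => 1 + |ε n ω i ^ 2 - σ ^ 2| ^ (2 + δ)) P :=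
    fun n i => (integrable_const _).add (hi n i)
  have hisq : ∀ n (i : Fin n), Integrable (fun ω => (ε n ω i ^ 2 - σ ^ 2) ^ 2) P := by
    intro n i
    refine (hint2 n i).mono' ((((hεm n i).pow_const 2).sub_const
      _).pow_const 2).aestronglyMeasurable (ae_of_all _ fun ω => ?_)
    rw [Real.norm_eq_abs, abs_of_nonneg (by positivity)]
    exact hsq n i ω
  refine RotiGCV.ae_tendsto_noiseDiag (v := 1 + K) h.measurable_design h.measurable_signal
    h.measurable_noise h.noise_indep h.noise_entries_indep hδ hδ1 (by linarith) hK0 hi ?_ ?_ hq hlam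
  · intro n i
    have i2 : Integrable (fun ω => ε n ω i ^ 2) P := by
      have := ((memLp_two_iff_integrable_sq (((hεm n i).pow_const 2).sub_const
        (σ ^ 2)).aestronglyMeasurable).2 (hisq n i)).integrable (by norm_num)
      exact (this.add (integrable_const (σ ^ 2))).congr (ae_of_all _ fun ω => by simp)
    rw [integral_sub i2 (integrable_const _), h.noise_variance]
    simp
  · intro n i
    refine (integral_mono (hisq n i) (hint2 n i) (hsq n i)).trans ?_
    rw [integral_add (integrable_const _) (hi n i)]
    simp only [integral_const, probReal_univ, smul_eq_mul, one_mul]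
    linarith [hq n i]

theorem TrainingModel.ae_signal_sq (h : TrainingModel P γ r σ p X Q D O β ε) {n : ℕ}
    (hn : n ≠ 0) : ∀ᵐ ω ∂P, β n ω ⬝ᵥ β n ω = r ^ 2 * n := by
  filter_upwards [h.signal_norm n (Nat.one_le_iff_ne_zero.2 hn)] with ω hω
  have hn' : (0 : ℝ) < n := by exact_mod_cast Nat.pos_of_ne_zero hn
  rw [← norm_toLp_sq, ← hω, div_pow, Real.sq_sqrt hn'.le]
  field_simp

/-- The almost sure limit of the classical GCV criterion. -/
theorem TrainingModel.ae_tendsto_gcv_sub [IsProbabilityMeasure P]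
    (h : TrainingModel P γ r σ p X Q D O β ε) (hγ : 0 < γ)
    {lam : ℝ} (hlam : 0 < lam) :
    ∀ᵐ ω ∂P, Tendsto (fun n : ℕ => gcv (X n ω) (response (X n) (β n) (ε n) ω) lam
      - gcvEquivalent γ r σ (D n ω) lam) atTop (𝓝 0) := by
  obtain ⟨κ, hκ⟩ := h.centeredFamily
  obtain ⟨C, hC⟩ := h.bounded
  have hβ : ∀ᵐ ω ∂P, ∀ n : ℕ, n ≠ 0 → β n ω ⬝ᵥ β n ω = r ^ 2 * n :=
    ae_all_iff.2 fun n => by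
      by_cases hn : n = 0
      · exact ae_of_all _ fun ω h0 => absurd hn h0
      · filter_upwards [h.ae_signal_sq hn] with ω hω _ using hω
  have hcross := ae_tendsto_linear h.measurable_design h.measurable_signal h.measurable_noise
    h.noise_indep hκ (u := fun n z => crossVec z.1 lam z.2) (K := r ^ 2 / lam / lam ^ 2)
    (fun n => (continuous_crossVec hlam).measurable) (fun n hn => by
      filter_upwards [h.ae_signal_sq hn] with ω hω
      refine (crossVec_sq_le hlam _).trans (le_of_eq ?_)
      rw [hω]; ring)
  filter_upwards [ae_tendsto_noiseOffDiag h.measurable_design h.measurable_signal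
      h.measurable_noise h.noise_indep hκ hlam, h.ae_tendsto_noiseDiag hlam, hcross,
    ae_tendsto_signalForm h.measurable_design h.measurable_signal h.signal_indep h.invariant hγ
      h.aspect_ratio (fun n hn => h.ae_signal_sq hn) hlam, hβ, hC, ae_all_iff.2 h.svd]
    with ω t1 t2 t3 t4 hb hCω hsvd
  have t5 : Tendsto (fun n : ℕ => r ^ 2 * (vD (D n ω) (-lam) - lam * deriv (vD (D n ω)) (-lam))
      * (((p n : ℝ) / n)⁻¹ - γ⁻¹)) atTop (𝓝 0) := by
    have h0 : Tendsto (fun n : ℕ => ((p n : ℝ) / n)⁻¹ - γ⁻¹) atTop (𝓝 0) := by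
      simpa using (h.aspect_ratio.inv₀ hγ.ne').sub_const γ⁻¹
    have h1 : Tendsto (fun n : ℕ => r ^ 2 * (1 / lam) * |((p n : ℝ) / n)⁻¹ - γ⁻¹|) atTop
        (𝓝 0) := by
      simpa using h0.abs.const_mul (r ^ 2 * (1 / lam))
    refine squeeze_zero_norm (fun n => ?_) h1
    rw [Real.norm_eq_abs, abs_mul, abs_mul, abs_of_nonneg (sq_nonneg r)]
    gcongr
    exact abs_vD_sub_le _ hlam
  have tsum := (((t1.add t2).add (t3.const_mul 2)).add t4).add t5
  -- `(C² + lam)²` dominates `1 / v_D²` as soon as the singular values are at most `C`.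
  have tabs := (tsum.abs).mul_const ((C ^ 2 + lam) ^ 2)
  simp only [add_zero, mul_zero, abs_zero, zero_mul] at tabs
  refine squeeze_zero_norm' ?_ tabs
  filter_upwards [hCω, eventually_ne_atTop 0,
    h.aspect_ratio.eventually_const_lt hγ] with n hn hn0 hpn
  have hp0 : p n ≠ 0 := by
    intro h0
    rw [h0] at hpn
    simp at hpn
  have hv := le_vD (D n ω) hn0 hlam ((hsvd n).diag_le hn)
  have hCl : 0 < C ^ 2 + lam := by positivity
  rw [response, (hsvd n).gcv_sub_gcvEquivalent hlam hn0 hp0 hγ.ne' _ (hb n hn0), Real.norm_eq_abs,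
    abs_div, abs_of_nonneg (sq_nonneg (vD (D n ω) (-lam))), div_eq_mul_inv]
  refine mul_le_mul_of_nonneg_left ?_ (abs_nonneg _)
  rw [← inv_pow]
  refine pow_le_pow_left₀ (inv_nonneg.2 ((by positivity : (0:ℝ) ≤ 1 / (C ^ 2 + lam)).trans hv)) ?_ 2
  rw [one_div] at hv
  exact inv_le_of_inv_le₀ hCl hv

end Model

/-! ### Haar measure on the orthogonal group -/

theorem isCompact_orthogonalGroup (n : ℕ) :
    IsCompact (Matrix.orthogonalGroup (Fin n) ℝ : Set (Matrix (Fin n) (Fin n) ℝ)) := by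
  have hbox : IsCompact {M : Matrix (Fin n) (Fin n) ℝ | ∀ i j, M i j ∈ Set.Icc (-1 : ℝ) 1} :=
    isCompact_Icc.matrix
  refine hbox.of_isClosed_subset ?_ fun M hM i j => ?_
  · have : (Matrix.orthogonalGroup (Fin n) ℝ : Set (Matrix (Fin n) (Fin n) ℝ))
        = {M | M * star M = 1} := by
      ext M; exact Matrix.mem_orthogonalGroup_iff _ _
    rw [this]
    exact isClosed_eq (by fun_prop) continuous_const
  · have := entry_norm_bound_of_unitary hM i j
    rwa [Real.norm_eq_abs, abs_le] at this

instance compactSpace_orthogonalGroup (n : ℕ) :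
    CompactSpace (Matrix.orthogonalGroup (Fin n) ℝ) :=
  isCompact_iff_compactSpace.1 (isCompact_orthogonalGroup n)

instance isTopologicalGroup_orthogonalGroup (n : ℕ) :
    IsTopologicalGroup (Matrix.orthogonalGroup (Fin n) ℝ) :=
  inferInstanceAs (IsTopologicalGroup (unitary (Matrix (Fin n) (Fin n) ℝ)))

instance borelSpace_orthogonalGroup (n : ℕ) : BorelSpace (Matrix.orthogonalGroup (Fin n) ℝ) :=
  Subtype.borelSpace _

/-- The Haar probability measure of the orthogonal group, as a law on matrices (of the inverse of
a left Haar distributed matrix). -/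
def haarOrthogonal (n : ℕ) : Measure (Matrix (Fin n) (Fin n) ℝ) :=
  (Measure.haarMeasure (⊤ : TopologicalSpace.PositiveCompacts
    (Matrix.orthogonalGroup (Fin n) ℝ))).map fun u => ((u⁻¹ : Matrix.orthogonalGroup (Fin n) ℝ) :
      Matrix (Fin n) (Fin n) ℝ)

theorem measurable_coe_inv_orthogonalGroup (n : ℕ) :
    Measurable fun u : Matrix.orthogonalGroup (Fin n) ℝ =>
      ((u⁻¹ : Matrix.orthogonalGroup (Fin n) ℝ) : Matrix (Fin n) (Fin n) ℝ) :=
  (continuous_subtype_val.comp continuous_inv).measurable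

instance isProbabilityMeasure_haarOrthogonal (n : ℕ) :
    IsProbabilityMeasure (haarOrthogonal n) := by
  have : IsProbabilityMeasure (Measure.haarMeasure (⊤ : TopologicalSpace.PositiveCompacts
      (Matrix.orthogonalGroup (Fin n) ℝ))) := ⟨Measure.haarMeasure_self⟩
  exact Measure.isProbabilityMeasure_map (measurable_coe_inv_orthogonalGroup n).aemeasurable

theorem measurableSet_orthogonalGroup (n : ℕ) :
    MeasurableSet (Matrix.orthogonalGroup (Fin n) ℝ : Set (Matrix (Fin n) (Fin n) ℝ)) :=
  (isCompact_orthogonalGroup n).measurableSet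

theorem ae_haarOrthogonal_mem (n : ℕ) :
    ∀ᵐ M ∂(haarOrthogonal n), M ∈ Matrix.orthogonalGroup (Fin n) ℝ := by
  exact (ae_map_iff (measurable_coe_inv_orthogonalGroup n).aemeasurable
    (measurableSet_orthogonalGroup n)).2 (ae_of_all _ fun u => (u⁻¹).2)

/-- Since `u⁻¹ O = (O⁻¹ u)⁻¹`, left invariance of Haar measure becomes right invariance after
inversion, so unimodularity is not needed. -/
theorem map_mul_right_haarOrthogonal {n : ℕ} {O : Matrix (Fin n) (Fin n) ℝ}
    (hO : O ∈ Matrix.orthogonalGroup (Fin n) ℝ) :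
    (haarOrthogonal n).map (fun M => M * O) = haarOrthogonal n := by
  set o : Matrix.orthogonalGroup (Fin n) ℝ := ⟨O, hO⟩ with ho
  have hm : Measurable fun M : Matrix (Fin n) (Fin n) ℝ => M * O :=
    (continuous_id.matrix_mul continuous_const).measurable
  set μ := Measure.haarMeasure (⊤ : TopologicalSpace.PositiveCompacts
    (Matrix.orthogonalGroup (Fin n) ℝ)) with hμ
  have hinv : μ.map (fun u => o⁻¹ * u) = μ := map_mul_left_eq_self μ o⁻¹
  have hmul : Measurable fun u : Matrix.orthogonalGroup (Fin n) ℝ => o⁻¹ * u :=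
    (continuous_const_mul o⁻¹).measurable
  rw [haarOrthogonal, ← hμ, Measure.map_map hm (measurable_coe_inv_orthogonalGroup n)]
  conv_rhs => rw [← hinv, Measure.map_map (measurable_coe_inv_orthogonalGroup n) hmul]
  congr 1
  ext1 u
  simp [ho]

/-! ### Dependence of the rows -/

section Rows

variable {Ω : Type*} [MeasurableSpace Ω] {P : Measure Ω} [IsProbabilityMeasure P]

/-- The rows of a rotationally invariant random orthogonal matrix are not independent. -/
theorem not_iIndepFun_rows {n : ℕ} (hn : 2 ≤ n) {X : Ω → Matrix (Fin n) (Fin n) ℝ}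
    (hX : Measurable X) (hinv : RightRotationallyInvariant P X)
    (horth : ∀ᵐ ω ∂P, X ω ∈ Matrix.orthogonalGroup (Fin n) ℝ) :
    ¬ iIndepFun (fun (i : Fin n) ω => X ω i) P := by
  intro hind
  set i : Fin n := ⟨0, by omega⟩ with hi
  set j : Fin n := ⟨1, by omega⟩ with hj
  have hij : j ≠ i := by simp [hi, hj]
  have hrow : ∀ k, Measurable fun M : Matrix (Fin n) (Fin n) ℝ => M k := fun k =>
    measurable_pi_apply k
  have hXr : ∀ k, Measurable fun ω => X ω k := fun k => (hrow k).comp hX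
  have hdot : ∀ k l, ∀ᵐ ω ∂P, X ω k ⬝ᵥ X ω l = if k = l then 1 else 0 := by
    intro k l
    filter_upwards [horth] with ω hω
    have h : X ω * (X ω)ᵀ = 1 := (Matrix.mem_orthogonalGroup_iff _ _).1 hω
    have := congrFun (congrFun h k) l
    rwa [Matrix.mul_apply, Matrix.one_apply] at this
  have hmap := (indepFun_iff_map_prod_eq_prod_map_map (hXr j).aemeasurable
    (hXr i).aemeasurable).1 (hind.indepFun hij)
  have hdm : Measurable fun z : (Fin n → ℝ) × (Fin n → ℝ) => z.1 ⬝ᵥ z.2 :=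
    (Continuous.dotProduct continuous_fst continuous_snd).measurable
  have hz : ∀ᵐ z ∂((P.map fun ω => X ω j).prod (P.map fun ω => X ω i)), z.1 ⬝ᵥ z.2 = 0 := by
    rw [← hmap, ae_map_iff ((hXr j).prodMk (hXr i)).aemeasurable
      (measurableSet_eq_fun hdm measurable_const)]
    filter_upwards [hdot j i] with ω hω
    rw [hω, if_neg hij]
  have : IsProbabilityMeasure (P.map fun ω => X ω j) :=
    Measure.isProbabilityMeasure_map (hXr j).aemeasurable
  have hsm : Measurable fun z : Fin n → ℝ => z ⬝ᵥ z :=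
    (Continuous.dotProduct continuous_id continuous_id).measurable
  have hunit : ∀ᵐ b ∂(P.map fun ω => X ω j), b ⬝ᵥ b = 1 := by
    rw [ae_map_iff (hXr j).aemeasurable (measurableSet_eq_fun hsm measurable_const)]
    filter_upwards [hdot j j] with ω hω
    rw [hω, if_pos rfl]
  -- Under independence, Fubini fixes one deterministic unit vector `b` almost surely orthogonal to
  -- row `i`. Rotating `b` to each basis vector then forces every coordinate of that unit row to
  -- vanish.
  obtain ⟨b, hb, hbb⟩ := ((Measure.ae_ae_of_ae_prod hz).and hunit).exists
  have hbm : Measurable fun a : Fin n → ℝ => b ⬝ᵥ a :=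
    (Continuous.dotProduct continuous_const continuous_id).measurable
  have hbs : MeasurableSet {a : Fin n → ℝ | b ⬝ᵥ a = 0} :=
    measurableSet_eq_fun hbm measurable_const
  have hcoord : ∀ k, ∀ᵐ ω ∂P, X ω i k = 0 := by
    intro k
    obtain ⟨O, hO, hOb⟩ := exists_orthogonal_mulVec_eq (b := b)
      (c := (Pi.single k 1 : Fin n → ℝ)) (by simp [hbb])
    have hXO : Measurable fun ω => X ω * O :=
      (continuous_id.matrix_mul continuous_const).measurable.comp hX
    have h1 : ∀ᵐ ω ∂P, b ⬝ᵥ (X ω * O) i = 0 := by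
      have h2 : ∀ᵐ M ∂(P.map X),
          M ∈ (fun M : Matrix (Fin n) (Fin n) ℝ => M i) ⁻¹' {a | b ⬝ᵥ a = 0} :=
        (ae_map_iff hX.aemeasurable ((hrow i) hbs)).2
          ((ae_map_iff (hXr i).aemeasurable hbs).1 hb)
      rw [← hinv O hO] at h2
      exact (ae_map_iff hXO.aemeasurable ((hrow i) hbs)).1 h2
    filter_upwards [h1] with ω hω
    have h3 : (X ω * O) i = (X ω i) ᵥ* O := rfl
    rw [h3, dotProduct_comm, ← Matrix.dotProduct_mulVec, hOb] at hω
    simpa using hω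
  obtain ⟨ω, hω, hω1⟩ := ((ae_all_iff.2 hcoord).and (hdot i i)).exists
  simp [dotProduct, hω] at hω1

end Rows

/-! ### Ridge regression with an orthogonal design -/

section OrthogonalDesign

variable {n : ℕ} {X : Matrix (Fin n) (Fin n) ℝ} {lam : ℝ}

theorem ridge_of_orthogonal (hX : X ∈ Matrix.orthogonalGroup (Fin n) ℝ) (hlam : 0 < lam)
    (y : Fin n → ℝ) : ridge X y lam = (1 / (1 + lam)) • (Xᵀ *ᵥ y) := by
  have h : Xᵀ * X = 1 := (Matrix.mem_orthogonalGroup_iff' _ _).1 hX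
  have h1 : Xᵀ * X + lam • (1 : Matrix (Fin n) (Fin n) ℝ) = (1 + lam) • 1 := by
    rw [h, add_smul, one_smul]
  have h2 : ((1 + lam) • (1 : Matrix (Fin n) (Fin n) ℝ))⁻¹ = (1 / (1 + lam)) • 1 := by
    refine Matrix.inv_eq_right_inv ?_
    rw [Matrix.smul_mul, Matrix.one_mul, smul_smul, mul_one_div_cancel (by linarith), one_smul]
  rw [ridge, h1, h2, Matrix.smul_mulVec, Matrix.one_mulVec]

/-- The error vector is `(Xᵀ e - lam b) / (1 + lam)`; expand its square, using that `Xᵀ` is an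
isometry. -/
theorem ridge_error_of_orthogonal (hX : X ∈ Matrix.orthogonalGroup (Fin n) ℝ) (hlam : 0 < lam)
    (b e : Fin n → ℝ) :
    (ridge X (X *ᵥ b + e) lam - b) ⬝ᵥ (ridge X (X *ᵥ b + e) lam - b)
      = (lam ^ 2 * (b ⬝ᵥ b) + e ⬝ᵥ e - 2 * lam * ((X *ᵥ b) ⬝ᵥ e)) / (1 + lam) ^ 2 := by
  have h : Xᵀ * X = 1 := (Matrix.mem_orthogonalGroup_iff' _ _).1 hX
  have h' : X * Xᵀ = 1 := (Matrix.mem_orthogonalGroup_iff _ _).1 hX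
  have hl : 1 + lam ≠ 0 := by linarith
  have h1 : ridge X (X *ᵥ b + e) lam - b = (1 / (1 + lam)) • (Xᵀ *ᵥ e - lam • b) := by
    rw [ridge_of_orthogonal hX hlam, Matrix.mulVec_add, Matrix.mulVec_mulVec, h, Matrix.one_mulVec]
    ext i
    simp only [Pi.sub_apply, Pi.smul_apply, Pi.add_apply, smul_eq_mul]
    field_simp
    ring
  have h2 : (Xᵀ *ᵥ e) ⬝ᵥ (Xᵀ *ᵥ e) = e ⬝ᵥ e := by
    rw [Matrix.dotProduct_mulVec, Matrix.vecMul_transpose, Matrix.mulVec_mulVec, h',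
      Matrix.one_mulVec]
  have h3 : (Xᵀ *ᵥ e) ⬝ᵥ b = (X *ᵥ b) ⬝ᵥ e := by
    rw [Matrix.mulVec_transpose, ← Matrix.dotProduct_mulVec, dotProduct_comm]
  rw [h1]
  simp only [smul_dotProduct, dotProduct_smul, sub_dotProduct, dotProduct_sub, smul_eq_mul, h2,
    dotProduct_comm b (Xᵀ *ᵥ e), h3]
  field_simp
  ring

/-- Cauchy–Schwarz bounds the cross term by `n`, so the numerator is at most `(1 + lam)² n`. This
provides the integrability for the conditional expectation. -/
theorem ridge_error_of_orthogonal_le (hX : X ∈ Matrix.orthogonalGroup (Fin n) ℝ) (hlam : 0 < lam)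
    {b e : Fin n → ℝ} (hb : b ⬝ᵥ b = n) (he : e ⬝ᵥ e = n) :
    (ridge X (X *ᵥ b + e) lam - b) ⬝ᵥ (ridge X (X *ᵥ b + e) lam - b) ≤ n := by
  rw [ridge_error_of_orthogonal hX hlam, hb, he, div_le_iff₀ (by positivity)]
  have h1 := dotProduct_sq_le (X *ᵥ b) e
  rw [orthogonal_mulVec_dotProduct hX, hb, he, ← pow_two] at h1
  have h2 := (abs_le.1 (abs_le_of_sq_le_sq h1 (Nat.cast_nonneg n))).1
  nlinarith

theorem continuous_ridge {n p : ℕ} {lam : ℝ} (hlam : 0 < lam) :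
    Continuous fun z : Matrix (Fin n) (Fin p) ℝ × (Fin n → ℝ) => ridge z.1 z.2 lam := by
  have hR : Continuous fun z : Matrix (Fin n) (Fin p) ℝ × (Fin n → ℝ) =>
      resolvent z.1ᵀ lam := (continuous_resolvent hlam).comp continuous_fst.matrix_transpose
  have := hR.matrix_mulVec (continuous_fst.matrix_transpose.matrix_mulVec continuous_snd)
  simp only [resolvent, Matrix.transpose_transpose] at this
  exact this

/-- Here `v_D = 1 / (1 + lam)` and `v_D' = v_D²`, so signal and noise each contribute `1`. -/
theorem gcvEquivalent_one {n : ℕ} (hn : n ≠ 0) (hlam : 0 < lam) :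
    gcvEquivalent 1 1 1 (1 : Matrix (Fin n) (Fin n) ℝ) lam = 2 := by
  have hn' : (n : ℝ) ≠ 0 := by exact_mod_cast hn
  have hl : 1 + lam ≠ 0 := by linarith
  rw [gcvEquivalent, vD_neg, deriv_vD_neg _ hlam]
  simp only [Matrix.transpose_one, Matrix.mul_one, Matrix.diag_one, Pi.one_apply,
    Finset.sum_const, Finset.card_univ, Fintype.card_fin, nsmul_eq_mul]
  field_simp
  ring

end OrthogonalDesign

/-! ### The Haar model and its risk -/

theorem indepFun_comp_measurePreserving {Ω Ω' α β : Type*} [MeasurableSpace Ω]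
    [MeasurableSpace Ω'] [MeasurableSpace α] [MeasurableSpace β] {P : Measure Ω} {P' : Measure Ω'}
    {π : Ω → Ω'} (hπ : MeasurePreserving π P P') {f : Ω' → α} {g : Ω' → β} (hf : Measurable f)
    (hg : Measurable g) (h : IndepFun f g P') :
    IndepFun (fun ω => f (π ω)) (fun ω => g (π ω)) P := by
  rw [indepFun_iff_measure_inter_preimage_eq_mul] at h ⊢
  intro s t hs ht
  have h1 := h s t hs ht
  rw [← hπ.measure_preimage (hf hs).nullMeasurableSet,
    ← hπ.measure_preimage (hg ht).nullMeasurableSet,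
    ← hπ.measure_preimage ((hf hs).inter (hg ht)).nullMeasurableSet] at h1
  exact h1

/-- The sample space of a test design, a training design and a noise vector of size `n`. -/
abbrev HaarSample (n : ℕ) : Type :=
  Matrix (Fin n) (Fin n) ℝ × (Matrix (Fin n) (Fin n) ℝ × (Fin n → ℝ))

/-- Two independent Haar orthogonal matrices and independent random signs. -/
def haarLaw (n : ℕ) : Measure (HaarSample n) :=
  (haarOrthogonal n).prod ((haarOrthogonal n).prod (signs n))

instance isProbabilityMeasure_haarLaw (n : ℕ) : IsProbabilityMeasure (haarLaw n) := by
  unfold haarLaw; infer_instance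

/-- The joint law over all sample sizes. -/
def haarModel : Measure ((n : ℕ) → HaarSample n) := Measure.infinitePi haarLaw

instance isProbabilityMeasure_haarModel : IsProbabilityMeasure haarModel := by
  unfold haarModel; infer_instance

/-- The training design. -/
def haarX (n : ℕ) (ω : (n : ℕ) → HaarSample n) : Matrix (Fin n) (Fin n) ℝ := (ω n).2.1

/-- The test design. -/
def haarX' (n : ℕ) (ω : (n : ℕ) → HaarSample n) : Matrix (Fin n) (Fin n) ℝ := (ω n).1

/-- The noise vector. -/
def haarNoise (n : ℕ) (ω : (n : ℕ) → HaarSample n) : Fin n → ℝ := (ω n).2.2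

/-- The signal. -/
def haarSignal (n : ℕ) (_ : (n : ℕ) → HaarSample n) : Fin n → ℝ := fun _ => 1

theorem measurePreserving_haarSample (n : ℕ) :
    MeasurePreserving (fun ω : (n : ℕ) → HaarSample n => ω n) haarModel (haarLaw n) :=
  measurePreserving_eval_infinitePi haarLaw n

theorem measurePreserving_haarSample_snd (n : ℕ) :
    MeasurePreserving (fun ω : (n : ℕ) → HaarSample n => (ω n).2) haarModel
      ((haarOrthogonal n).prod (signs n)) :=
  measurePreserving_snd.comp (measurePreserving_haarSample n)

theorem measurePreserving_haarX (n : ℕ) :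
    MeasurePreserving (haarX n) haarModel (haarOrthogonal n) :=
  measurePreserving_fst.comp (measurePreserving_haarSample_snd n)

theorem measurePreserving_haarX' (n : ℕ) :
    MeasurePreserving (haarX' n) haarModel (haarOrthogonal n) :=
  measurePreserving_fst.comp (measurePreserving_haarSample n)

theorem measurePreserving_haarNoise (n : ℕ) :
    MeasurePreserving (haarNoise n) haarModel (signs n) :=
  measurePreserving_snd.comp (measurePreserving_haarSample_snd n)

theorem measurePreserving_haarNoise_apply {n : ℕ} (i : Fin n) :
    MeasurePreserving (fun ω => haarNoise n ω i) haarModel rademacher :=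
  (measurePreserving_eval_signs i).comp (measurePreserving_haarNoise n)

theorem integral_haarNoise {n : ℕ} (i : Fin n) {f : ℝ → ℝ} (hf : Measurable f) :
    ∫ ω, f (haarNoise n ω i) ∂haarModel = (f 1 + f (-1)) / 2 := by
  have h := measurePreserving_haarNoise_apply i
  rw [← integral_rademacher, ← h.map_eq,
    integral_map h.measurable.aemeasurable hf.aestronglyMeasurable]

theorem ae_haarX_mem (n : ℕ) : ∀ᵐ ω ∂haarModel, haarX n ω ∈ Matrix.orthogonalGroup (Fin n) ℝ :=
  (measurePreserving_haarX n).quasiMeasurePreserving.ae (ae_haarOrthogonal_mem n)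

theorem ae_haarX'_mem (n : ℕ) : ∀ᵐ ω ∂haarModel, haarX' n ω ∈ Matrix.orthogonalGroup (Fin n) ℝ :=
  (measurePreserving_haarX' n).quasiMeasurePreserving.ae (ae_haarOrthogonal_mem n)

theorem ae_haarNoise_sq (n : ℕ) : ∀ᵐ ω ∂haarModel, haarNoise n ω ⬝ᵥ haarNoise n ω = n := by
  filter_upwards [(measurePreserving_haarNoise n).quasiMeasurePreserving.ae (ae_signs_sq n)]
    with ω hω
  simp [dotProduct, ← pow_two, hω]

theorem haarSignal_sq (n : ℕ) (ω : (n : ℕ) → HaarSample n) :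
    haarSignal n ω ⬝ᵥ haarSignal n ω = n := by
  simp [dotProduct, haarSignal]

theorem rightRotationallyInvariant_haarX (n : ℕ) :
    RightRotationallyInvariant haarModel (haarX n) := by
  intro O hO
  have hm : Measurable fun M : Matrix (Fin n) (Fin n) ℝ => M * O :=
    (continuous_id.matrix_mul continuous_const).measurable
  have h := (measurePreserving_haarX n)
  rw [h.map_eq]
  conv_rhs => rw [← map_mul_right_haarOrthogonal hO, ← h.map_eq, Measure.map_map hm h.measurable]
  rfl

theorem isSVD_of_orthogonal {n : ℕ} {X : Matrix (Fin n) (Fin n) ℝ}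
    (hX : X ∈ Matrix.orthogonalGroup (Fin n) ℝ) : IsSVD X 1 1 X where
  left_orthogonal := one_mem _
  right_orthogonal := hX
  diagonal i j hij := Matrix.one_apply_ne fun h => hij (congrArg Fin.val h)
  nonneg i j := by rw [Matrix.one_apply]; split_ifs <;> norm_num
  eq := by simp

theorem indepFun_haarNoise (n : ℕ) :
    IndepFun (haarNoise n) (fun ω => (haarX n ω, haarSignal n ω)) haarModel := by
  have h : IndepFun (fun z : Matrix (Fin n) (Fin n) ℝ × (Fin n → ℝ) => z.1) (fun z => z.2)
      ((haarOrthogonal n).prod (signs n)) := indepFun_prod measurable_id measurable_id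
  have h2 := indepFun_comp_measurePreserving (measurePreserving_haarSample_snd n) measurable_fst
    measurable_snd h
  exact h2.symm.comp (φ := id) (ψ := fun M => (M, fun _ => 1)) measurable_id (by fun_prop)

theorem indepFun_haarX' (n : ℕ) :
    IndepFun (haarX' n) (fun ω => (haarX n ω, haarSignal n ω, haarNoise n ω)) haarModel := by
  have h : IndepFun (fun z : HaarSample n => z.1) (fun z => z.2) (haarLaw n) :=
    indepFun_prod measurable_id measurable_id
  have h2 := indepFun_comp_measurePreserving (measurePreserving_haarSample n) measurable_fst
    measurable_snd h
  exact h2.comp (φ := id) (ψ := fun z : Matrix (Fin n) (Fin n) ℝ × (Fin n → ℝ) =>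
    (z.1, (fun _ => 1 : Fin n → ℝ), z.2)) measurable_id
    (measurable_fst.prodMk (measurable_const.prodMk measurable_snd))

theorem iIndepFun_haarNoise (n : ℕ) :
    iIndepFun (fun (i : Fin n) ω => haarNoise n ω i) haarModel := by
  rw [iIndepFun_iff_map_fun_eq_pi_map fun i =>
    (measurePreserving_haarNoise_apply i).measurable.aemeasurable]
  simp only [fun i => (measurePreserving_haarNoise_apply (n := n) i).map_eq]
  exact (measurePreserving_haarNoise n).map_eq

theorem trainingModel_haar :
    TrainingModel haarModel 1 1 1 (fun n => n) haarX (fun _ _ => 1) (fun _ _ => 1) haarX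
      haarSignal haarNoise where
  measurable_design n := (measurePreserving_haarX n).measurable
  measurable_signal n := measurable_const
  measurable_noise n := (measurePreserving_haarNoise n).measurable
  invariant := rightRotationallyInvariant_haarX
  svd n := by
    filter_upwards [ae_haarX_mem n] with ω hω
    exact isSVD_of_orthogonal hω
  bounded := ⟨1, ae_of_all _ fun ω => Eventually.of_forall fun n i j => by
    rw [Matrix.one_apply]; split_ifs <;> norm_num⟩
  aspect_ratio := by
    refine tendsto_const_nhds.congr' ?_
    filter_upwards [eventually_ne_atTop 0] with n hn
    exact (div_self (by exact_mod_cast hn)).symm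
  signal_norm n hn := ae_of_all _ fun ω => by
    have hn' : (0 : ℝ) < n := by exact_mod_cast hn
    have h := norm_toLp_sq (haarSignal n ω)
    rw [haarSignal_sq] at h
    rw [← h, Real.sqrt_sq (norm_nonneg _), div_self]
    intro h0
    rw [h0] at h
    simp at h
    linarith
  signal_indep n := indepFun_const_left _ _
  noise_indep := indepFun_haarNoise
  noise_entries_indep := iIndepFun_haarNoise
  noise_mean n i := by rw [integral_haarNoise i (f := fun x => x) (by fun_prop)]; norm_num
  noise_variance n i := by
    rw [integral_haarNoise i (f := fun x => x ^ 2) (by fun_prop)]; norm_num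
  noise_moment := ⟨1, one_pos, 1, fun n i =>
    ⟨(measurePreserving_haarNoise_apply i).integrable_comp_of_integrable
      (g := fun x : ℝ => |x| ^ ((4 : ℝ) + 1)) (integrable_rademacher _), by
      rw [integral_haarNoise i (f := fun x => |x| ^ ((4 : ℝ) + 1))
        (measurable_id.abs.pow_const _)]
      norm_num⟩⟩

/-- The test design is an isometry and drops out. The signal is constant, so the squared error is a
function of `(X, y)` and equals its own conditional expectation. -/
theorem ae_risk_haar {n : ℕ} {lam : ℝ} (hlam : 0 < lam) :
    ∀ᵐ ω ∂haarModel,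
      risk haarModel (haarX n) (haarSignal n) (response (haarX n) (haarSignal n) (haarNoise n))
        (haarX' n) lam ω
      = (1 / (n : ℝ)) * ((lam ^ 2 * n + n
          - 2 * lam * ((haarX n ω *ᵥ haarSignal n ω) ⬝ᵥ haarNoise n ω)) / (1 + lam) ^ 2) := by
  set y := response (haarX n) (haarSignal n) (haarNoise n) with hy
  have hX := (measurePreserving_haarX n).measurable
  have hε := (measurePreserving_haarNoise n).measurable
  have hym : Measurable y := by
    have h : Measurable fun z : Matrix (Fin n) (Fin n) ℝ × (Fin n → ℝ) =>
        z.1 *ᵥ (fun _ => (1 : ℝ)) + z.2 :=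
      ((continuous_fst.matrix_mulVec continuous_const).add continuous_snd).measurable
    exact h.comp (hX.prodMk hε)
  set g : Matrix (Fin n) (Fin n) ℝ × (Fin n → ℝ) → ℝ := fun z =>
    (ridge z.1 z.2 lam - fun _ => 1) ⬝ᵥ (ridge z.1 z.2 lam - fun _ => 1) with hg
  have hgm : Measurable g := by
    have h := (continuous_ridge (n := n) (p := n) hlam).sub
      (continuous_const (y := fun _ : Fin n => (1 : ℝ)))
    exact (h.dotProduct h).measurable
  have hXy : Measurable fun ω => (haarX n ω, y ω) := hX.prodMk hym
  have hval : (fun ω => ‖WithLp.toLp 2 (haarX' n ω *ᵥ ridge (haarX n ω) (y ω) lam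
      - haarX' n ω *ᵥ haarSignal n ω)‖ ^ 2) =ᵐ[haarModel] fun ω => g (haarX n ω, y ω) := by
    filter_upwards [ae_haarX'_mem n] with ω hω
    rw [norm_toLp_sq, ← Matrix.mulVec_sub, orthogonal_mulVec_dotProduct hω]
    rfl
  have hint : Integrable (fun ω => g (haarX n ω, y ω)) haarModel := by
    refine (integrable_const (n : ℝ)).mono' (hgm.comp hXy).aestronglyMeasurable ?_
    filter_upwards [ae_haarX_mem n, ae_haarNoise_sq n] with ω hω he
    rw [Real.norm_eq_abs, abs_of_nonneg (dotProduct_self_nonneg' _)]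
    exact ridge_error_of_orthogonal_le hω hlam (haarSignal_sq n ω) he
  have hce : haarModel[fun ω => g (haarX n ω, y ω) | MeasurableSpace.comap
      (fun ω => (haarX n ω, y ω)) inferInstance] = fun ω => g (haarX n ω, y ω) :=
    condExp_of_stronglyMeasurable hXy.comap_le
      (hgm.comp (comap_measurable _)).stronglyMeasurable hint
  have hcong := condExp_congr_ae (m := MeasurableSpace.comap
      (fun ω => (haarX n ω, y ω)) inferInstance) hval
  rw [hce] at hcong
  filter_upwards [hcong, ae_haarX_mem n, ae_haarNoise_sq n] with ω h1 hω he
  rw [risk, h1]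
  congr 1
  have := ridge_error_of_orthogonal hω hlam (haarSignal n ω) (haarNoise n ω)
  rw [haarSignal_sq, he] at this
  exact this

/-- The cross term in the risk vanishes by `ae_tendsto_linear`, since `X β` has squared norm `n`.
What is left is `1 - (lam² + 1) / (1 + lam)²`. -/
theorem ae_tendsto_gcvEquivalent_sub_risk_haar {lam : ℝ} (hlam : 0 < lam) :
    ∀ᵐ ω ∂haarModel, Tendsto (fun n : ℕ => gcvEquivalent 1 1 1 (1 : Matrix (Fin n) (Fin n) ℝ) lam
      - (risk haarModel (haarX n) (haarSignal n)
          (response (haarX n) (haarSignal n) (haarNoise n)) (haarX' n) lam ω + 1 ^ 2))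
      atTop (𝓝 (2 * lam / (1 + lam) ^ 2)) := by
  have h := trainingModel_haar
  obtain ⟨κ, hκ⟩ := h.centeredFamily
  have hcross := ae_tendsto_linear (p := fun n => n) h.measurable_design h.measurable_signal
    h.measurable_noise h.noise_indep hκ (u := fun n z => z.1 *ᵥ z.2) (K := 1)
    (fun n => (continuous_fst.matrix_mulVec continuous_snd).measurable) (fun n hn => by
      filter_upwards [ae_haarX_mem n] with ω hω
      rw [orthogonal_mulVec_dotProduct hω, haarSignal_sq, one_mul])
  filter_upwards [hcross, ae_all_iff.2 fun n => ae_risk_haar (n := n) hlam] with ω h1 h2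
  have h3 : Tendsto (fun n : ℕ => 1 - (lam ^ 2 + 1 - 2 * lam * ((1 / (n : ℝ))
      * ((haarX n ω *ᵥ haarSignal n ω) ⬝ᵥ haarNoise n ω))) / (1 + lam) ^ 2) atTop
      (𝓝 (1 - (lam ^ 2 + 1 - 2 * lam * 0) / (1 + lam) ^ 2)) :=
    (((h1.const_mul (2 * lam)).const_sub (lam ^ 2 + 1)).div_const ((1 + lam) ^ 2)).const_sub 1
  have hl : (1 + lam) ≠ 0 := by linarith
  have hlim : 1 - (lam ^ 2 + 1 - 2 * lam * 0) / (1 + lam) ^ 2 = 2 * lam / (1 + lam) ^ 2 := by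
    field_simp; ring
  rw [hlim] at h3
  refine h3.congr' ?_
  filter_upwards [eventually_ne_atTop 0] with n hn
  have hn' : (n : ℝ) ≠ 0 := by exact_mod_cast hn
  rw [gcvEquivalent_one hn hlam, h2 n]
  field_simp
  ring

theorem integral_trace_haarX' (n : ℕ) :
    ∫ ω, ((haarX' n ω)ᵀ * haarX' n ω).trace ∂haarModel = (n : ℝ) := by
  have h : (fun ω => ((haarX' n ω)ᵀ * haarX' n ω).trace) =ᵐ[haarModel] fun _ => (n : ℝ) := by
    filter_upwards [ae_haarX'_mem n] with ω hω
    have h1 : (haarX' n ω)ᵀ * haarX' n ω = 1 := (Matrix.mem_orthogonalGroup_iff' _ _).1 hω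
    rw [h1]; simp
  rw [integral_congr_ae h]
  simp

end RotiGCV

end

open RotiGCV in
theorem mainTheorem3 :
    -- the almost sure limit of the classical GCV criterion
    (∀ (Ω : Type*) [MeasurableSpace Ω] (P : Measure Ω) [IsProbabilityMeasure P]
      (γ r σ : ℝ) (p : ℕ → ℕ)
      (X : (n : ℕ) → Ω → Matrix (Fin n) (Fin (p n)) ℝ)
      (Q : (n : ℕ) → Ω → Matrix (Fin n) (Fin n) ℝ)
      (D : (n : ℕ) → Ω → Matrix (Fin n) (Fin (p n)) ℝ)
      (O : (n : ℕ) → Ω → Matrix (Fin (p n)) (Fin (p n)) ℝ)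
      (β : (n : ℕ) → Ω → Fin (p n) → ℝ)
      (ε : (n : ℕ) → Ω → Fin n → ℝ),
      0 < γ → TrainingModel P γ r σ p X Q D O β ε →
      ∀ lam : ℝ, 0 < lam →
        ∀ᵐ ω ∂P, Tendsto
          (fun n : ℕ => gcv (X n ω) (response (X n) (β n) (ε n) ω) lam
            - gcvEquivalent γ r σ (D n ω) lam) atTop (𝓝 0)) ∧
    -- a model with dependent rows in which GCV does not match the risk, even when the test
    -- design is an independent copy of the training design
    (∃ (Ω : Type) (_ : MeasurableSpace Ω) (P : Measure Ω) (_ : IsProbabilityMeasure P)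
      (γ r σ : ℝ) (p : ℕ → ℕ)
      (X : (n : ℕ) → Ω → Matrix (Fin n) (Fin (p n)) ℝ)
      (Q : (n : ℕ) → Ω → Matrix (Fin n) (Fin n) ℝ)
      (D : (n : ℕ) → Ω → Matrix (Fin n) (Fin (p n)) ℝ)
      (O : (n : ℕ) → Ω → Matrix (Fin (p n)) (Fin (p n)) ℝ)
      (β : (n : ℕ) → Ω → Fin (p n) → ℝ)
      (ε : (n : ℕ) → Ω → Fin n → ℝ)
      (X' : (n : ℕ) → Ω → Matrix (Fin n) (Fin (p n)) ℝ),
      0 < γ ∧ 0 < r ∧ 0 < σ ∧ TrainingModel P γ r σ p X Q D O β ε ∧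
      (∀ n, 2 ≤ n → ¬ iIndepFun (fun (i : Fin n) ω => X n ω i) P) ∧
      (∀ n, IdentDistrib (X' n) (X n) P P) ∧
      (∀ n, IndepFun (X' n) (fun ω => (X n ω, β n ω, ε n ω)) P) ∧
      (∀ n, ∫ ω, ((X' n ω)ᵀ * X' n ω).trace ∂P = (p n : ℝ)) ∧
      ∀ lam : ℝ, 0 < lam → ∀ᵐ ω ∂P,
        ¬ Tendsto (fun n : ℕ => gcvEquivalent γ r σ (D n ω) lam
            - (risk P (X n) (β n) (response (X n) (β n) (ε n)) (X' n) lam ω + σ ^ 2))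
          atTop (𝓝 0) ∧
        ¬ Tendsto (fun n : ℕ => gcv (X n ω) (response (X n) (β n) (ε n) ω) lam
            - (risk P (X n) (β n) (response (X n) (β n) (ε n)) (X' n) lam ω + σ ^ 2))
          atTop (𝓝 0)) := by
  refine ⟨fun Ω _ P _ γ r σ p X Q D O β ε hγ h lam hlam => h.ae_tendsto_gcv_sub hγ hlam, ?_⟩
  refine ⟨(n : ℕ) → HaarSample n, inferInstance, haarModel, inferInstance, 1, 1, 1, fun n => n,
    haarX, fun _ _ => 1, fun _ _ => 1, haarX, haarSignal, haarNoise, haarX', one_pos, one_pos,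
    one_pos, trainingModel_haar,
    fun n hn => not_iIndepFun_rows hn (measurePreserving_haarX n).measurable
      (rightRotationallyInvariant_haarX n) (ae_haarX_mem n),
    fun n => ⟨(measurePreserving_haarX' n).measurable.aemeasurable,
      (measurePreserving_haarX n).measurable.aemeasurable,
      (measurePreserving_haarX' n).map_eq.trans (measurePreserving_haarX n).map_eq.symm⟩,
    indepFun_haarX', integral_trace_haarX', fun lam hlam => ?_⟩
  have hpos : 2 * lam / (1 + lam) ^ 2 ≠ 0 := by positivity
  filter_upwards [ae_tendsto_gcvEquivalent_sub_risk_haar hlam,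
    trainingModel_haar.ae_tendsto_gcv_sub one_pos hlam] with ω h1 h2
  refine ⟨fun h => hpos (tendsto_nhds_unique h1 h), fun h => hpos ?_⟩
  -- GCV and its equivalent differ by a null sequence, so both have the same nonzero gap to the risk
  -- plus noise level.
  have h3 := h2.add h1
  simp only [sub_add_sub_cancel, zero_add] at h3
  exact tendsto_nhds_unique h3 h
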